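/- Let $L\ge 0$ be an integer and let $a_1,\dots,a_L,b_1,\dots,b_L$ be real numbers with $a_j\le b_j$ for all $j$ such that $S=\bigcup_{j=1}^L[a_j,b_j]\subseteq[0,1]$ (the intervals are not required to be disjoint). For real $\lambda$ put $e_\lambda(t)=e^{2\pi i\lambda t}$, and for $\Lambda\subseteq\mathbb{R}$ let $E(\Lambda)=\{e_\lambda\}_{\lambda\in\Lambda}$, regarded as a system in $L^2(S)$. A system of vectors in a Hilbert space $H$ is called a Riesz basis of $H$ if it is the image of an orthonormal basis of $H$ under a bounded invertible operator $H\to H$. If the $2L+1$ numbers $a_1,\dots,a_L,b_1,\dots,b_L,1$ are linearly independent over $\mathbb{Q}$ (as a family, so in particular they are pairwise distinct), then there is a set $\Lambda\subseteq\mathbb{Z}$ such that $E(\Lambda)$ is a Riesz basis of $L^2(S)$. -/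

import Mathlib

open MeasureTheory Set

/-- A system of vectors `f : ι → H` of a complex Hilbert space is a *Riesz basis* if it is the image
of an orthonormal basis of `H` under a bounded invertible operator `H → H`. -/
def IsRieszBasis {ι H : Type*} [NormedAddCommGroup H] [InnerProductSpace ℂ H] [CompleteSpace H]
    (f : ι → H) : Prop :=
  ∃ (e : HilbertBasis ι ℂ H) (T : H ≃L[ℂ] H), ∀ i, f i = T (e i)

/-- The exponential `e_l(t) = exp(2 π i l t)` of real frequency `l`. -/
noncomputable def expFun (l t : ℝ) : ℂ :=
  Complex.exp (2 * Real.pi * Complex.I * l * t)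

/-- The system of exponentials with frequencies `(freq i)_i` is a Riesz basis of `L²(S)`: the
exponentials restricted to `S` belong to `L²(S)`, and their classes `f i` there (uniquely determined
by almost everywhere equality on `S`) form a Riesz basis of that space. -/
def IsExpRieszBasis (S : Set ℝ) {ι : Type*} (freq : ι → ℝ) : Prop :=
  ∃ f : ι → Lp ℂ 2 (volume.restrict S),
    (∀ i, f i =ᵐ[volume.restrict S] expFun (freq i)) ∧ IsRieszBasis f

/-! The method is to combine Riesz bases along the `N`-fold covering `t ↦ N • t` of the circle. For
`j < N` let `B j` be the set of points with more than `j` preimages in `S`. If integer frequencies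
`Λ j` give a Riesz basis over each `B j`, then the union of the sets `N Λ j + j` gives one over `S`.
Indeed, a trigonometric polynomial splits by residues modulo `N` into pieces `fourier j t * f j (N •
t)`, and its values on a fiber of the covering are a Vandermonde transform of these pieces.

On a fiber with `r` points in `S` the first `r` pieces are controlled by the values on `S` and the
remaining pieces. Back-substitution from the largest `j` downwards then yields the lower Riesz bound
(`hasRieszLowerBound_combine`). Dually, completeness follows by an upward induction on `j` with the
transposed Vandermonde system (`isCompleteOn_combine`). The upper bound is free, since integer
exponentials are orthonormal on the whole circle.

Independence over `ℚ` enters through Kronecker's theorem: some `N` puts every `N * a j` modulo 1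
just below `1/2` and every `N * b j` just above. As a point moves through `[0, 1]`, the number of
its preimages in `S` is constant up to `0.45`, only increases up to `1/2`, only decreases up to
`0.55`, and is constant again. Hence every level set is the whole circle or an interval inside
`[0.45, 0.55]` (`exists_frequencies_levelSet`).

The whole circle has the basis of all integer exponentials. On an interval of length `ℓ ≤ 1/10` the
orthogonal basis of frequencies `n / ℓ` survives rounding to the nearest integers: the angular error
is at most `π`, and `π * ℓ ≤ 1/2`, so the Paley–Wiener estimate `integral_norm_sq_perturbation_le`
applies. -/

/-! ### Riesz bases from two-sided bounds and completeness -/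

theorem Orthonormal.countable_index {ι H : Type*} [NormedAddCommGroup H] [InnerProductSpace ℂ H]
    [TopologicalSpace.SeparableSpace H] {v : ι → H} (hv : Orthonormal ℂ v) : Countable ι := by
  have hd : ∀ i j, i ≠ j → 1 ≤ dist (v i) (v j) := by
    intro i j hij
    have h := norm_sub_sq (𝕜 := ℂ) (v i) (v j)
    rw [hv.2 hij, hv.1, hv.1] at h
    simp only [map_zero, mul_zero, sub_zero, one_pow] at h
    rw [dist_eq_norm]
    nlinarith [norm_nonneg (v i - v j)]
  have hc : (Set.univ : Set ι).Countable := by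
    refine Set.PairwiseDisjoint.countable_of_isOpen (s := fun i => Metric.ball (v i) (1 / 2)) ?_
      (fun i _ => Metric.isOpen_ball) (fun i _ => ⟨v i, by simp⟩)
    intro i _ j _ hij
    exact Metric.ball_disjoint_ball (by linarith [hd i j hij])
  exact Set.countable_univ_iff.mp hc

theorem HilbertBasis.hasSum_norm_inner_sq {ι H : Type*} [NormedAddCommGroup H]
    [InnerProductSpace ℂ H] (e : HilbertBasis ι ℂ H) (x : H) :
    HasSum (fun i => ‖inner ℂ (e i) x‖ ^ 2) (‖x‖ ^ 2) := by
  have h := e.hasSum_inner_mul_inner x x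
  rw [inner_self_eq_norm_sq_to_K] at h
  have h2 := Complex.hasSum_re h
  convert h2 using 1
  · funext i
    rw [← inner_conj_symm x (e i), RCLike.conj_mul]
    norm_cast
  · norm_cast

section RieszBasis

variable {ι H : Type*} [NormedAddCommGroup H] [InnerProductSpace ℂ H] [CompleteSpace H]

/-- Being a Riesz basis demands an orthonormal basis with the same index type, so only cardinalities
matter. For finite `ι` the family `f` is an algebraic basis and fixes the dimension; for infinite
`ι` every orthonormal basis is countably infinite and can be reindexed. -/
theorem exists_hilbertBasis_of_linearIndependent [TopologicalSpace.SeparableSpace H] [Countable ι]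
    {f : ι → H} (hf : LinearIndependent ℂ f) (hd : ∀ h, (∀ i, inner ℂ (f i) h = 0) → h = 0) :
    Nonempty (HilbertBasis ι ℂ H) := by
  classical
  rcases finite_or_infinite ι with hι | hι
  · have := Fintype.ofFinite ι
    have hfd : FiniteDimensional ℂ (Submodule.span ℂ (Set.range f)) :=
      FiniteDimensional.span_of_finite ℂ (Set.finite_range f)
    have htop : Submodule.span ℂ (Set.range f) = ⊤ := by
      rw [← Submodule.orthogonal_eq_bot_iff, Submodule.eq_bot_iff]
      intro x hx
      exact hd x fun i => hx _ (Submodule.subset_span ⟨i, rfl⟩)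
    let B := Module.Basis.mk hf htop.ge
    have : FiniteDimensional ℂ H := Module.Basis.finiteDimensional_of_finite B
    have hcard : Module.finrank ℂ H = Fintype.card ι := Module.finrank_eq_card_basis B
    let e : Fin (Module.finrank ℂ H) ≃ ι := Fintype.equivOfCardEq (by simp [hcard])
    exact ⟨((stdOrthonormalBasis ℂ H).reindex e).toHilbertBasis⟩
  · obtain ⟨w, b, hb⟩ := exists_hilbertBasis ℂ H
    have hw : Countable w := b.orthonormal.countable_index
    have hwi : Infinite w := by
      by_contra hfin
      rw [not_infinite_iff_finite] at hfin
      have := Fintype.ofFinite w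
      have : FiniteDimensional ℂ H :=
        Module.Basis.finiteDimensional_of_finite b.toOrthonormalBasis.toBasis
      exact not_finite_iff_infinite.mpr hι hf.finite
    obtain ⟨e⟩ := nonempty_equiv_of_countable (α := ι) (β := w)
    refine ⟨HilbertBasis.mk (v := b ∘ e) (b.orthonormal.comp e e.injective) ?_⟩
    rw [Set.range_comp, e.surjective.range_eq, Set.image_univ, b.dense_span]

/-- A complete system satisfying the two-sided Riesz inequality is a Riesz basis. -/
theorem isRieszBasis_of_bounds [TopologicalSpace.SeparableSpace H] [Countable ι]
    {f : ι → H} {A B : ℝ} (hA : 0 < A)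
    (hlow : ∀ (s : Finset ι) (c : ι → ℂ), A * ∑ i ∈ s, ‖c i‖ ^ 2 ≤ ‖∑ i ∈ s, c i • f i‖ ^ 2)
    (hup : ∀ (s : Finset ι) (c : ι → ℂ), ‖∑ i ∈ s, c i • f i‖ ^ 2 ≤ B * ∑ i ∈ s, ‖c i‖ ^ 2)
    (hd : ∀ h, (∀ i, inner ℂ (f i) h = 0) → h = 0) : IsRieszBasis f := by
  classical
  have hlin : LinearIndependent ℂ f := by
    rw [linearIndependent_iff']
    intro s c hc i hi
    have h := hlow s c
    rw [hc, norm_zero] at h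
    have h2 : ∑ i ∈ s, ‖c i‖ ^ 2 ≤ 0 := by nlinarith
    have h3 := Finset.single_le_sum (f := fun i => ‖c i‖ ^ 2) (fun i _ => by positivity) hi
    have h4 : ‖c i‖ ^ 2 ≤ 0 := h3.trans h2
    exact norm_eq_zero.mp (pow_eq_zero_iff two_ne_zero |>.mp (le_antisymm h4 (by positivity)))
  obtain ⟨e⟩ := exists_hilbertBasis_of_linearIndependent hlin hd
  have hsq := e.hasSum_norm_inner_sq
  have hsum : ∀ x, Summable fun i => inner ℂ (e i) x • f i := by
    intro x
    rw [summable_iff_vanishing_norm]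
    intro ε hε
    obtain ⟨s, hs⟩ := summable_iff_vanishing_norm.mp (hsq x).summable (ε ^ 2 / (|B| + 1))
      (by positivity)
    refine ⟨s, fun t ht => ?_⟩
    have h1 := hs t ht
    rw [Real.norm_of_nonneg (Finset.sum_nonneg fun i _ => by positivity),
      lt_div_iff₀ (by positivity)] at h1
    have h2 := hup t fun i => inner ℂ (e i) x
    have h3 : (0 : ℝ) ≤ ∑ i ∈ t, ‖inner ℂ (e i) x‖ ^ 2 := Finset.sum_nonneg fun i _ => by positivity
    refine lt_of_pow_lt_pow_left₀ 2 hε.le ?_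
    nlinarith [le_abs_self B]
  -- The synthesis operator, which carries `e i` to `f i`; the two Riesz inequalities pass to the
  -- limit and bound it from above and below.
  let T₀ : H →ₗ[ℂ] H :=
    { toFun := fun x => ∑' i, inner ℂ (e i) x • f i
      map_add' := fun x y => by
        simp only [inner_add_right, add_smul]
        exact (hsum x).tsum_add (hsum y)
      map_smul' := fun c x => by
        simp only [inner_smul_right, mul_smul, RingHom.id_apply]
        exact (hsum x).tsum_const_smul c }
  have hlim : ∀ x, Filter.Tendsto (fun s : Finset ι => ‖∑ i ∈ s, inner ℂ (e i) x • f i‖ ^ 2)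
      Filter.atTop (nhds (‖T₀ x‖ ^ 2)) := fun x => ((hsum x).hasSum.norm).pow 2
  have hTup : ∀ x, ‖T₀ x‖ ^ 2 ≤ B * ‖x‖ ^ 2 := fun x =>
    le_of_tendsto_of_tendsto' (hlim x) (Filter.Tendsto.const_mul B (hsq x)) fun s => hup s _
  have hTlow : ∀ x, A * ‖x‖ ^ 2 ≤ ‖T₀ x‖ ^ 2 := fun x =>
    le_of_tendsto_of_tendsto' (Filter.Tendsto.const_mul A (hsq x)) (hlim x) fun s => hlow s _
  have hTe : ∀ i, T₀ (e i) = f i := by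
    intro i
    change ∑' j, inner ℂ (e j) (e i) • f j = f i
    rw [tsum_eq_single i]
    · rw [inner_self_eq_norm_sq_to_K, e.orthonormal.1 i]; simp
    · intro j hj
      rw [e.orthonormal.2 hj, zero_smul]
  let T : H →L[ℂ] H := T₀.mkContinuous (Real.sqrt |B|) fun x => by
    refine (sq_le_sq₀ (by positivity) (by positivity)).mp ?_
    rw [mul_pow, Real.sq_sqrt (abs_nonneg B)]
    exact (hTup x).trans (mul_le_mul_of_nonneg_right (le_abs_self B) (by positivity))
  have hTT : ∀ x, T x = T₀ x := fun x => rfl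
  have hanti : AntilipschitzWith (Real.toNNReal (Real.sqrt A)⁻¹) T := by
    refine T.antilipschitz_of_bound fun x => ?_
    rw [Real.coe_toNNReal _ (by positivity), ← div_eq_inv_mul, le_div_iff₀ (by positivity)]
    refine (sq_le_sq₀ (by positivity) (by positivity)).mp ?_
    rw [mul_pow, Real.sq_sqrt hA.le, mul_comm]
    exact hTlow x
  -- The lower bound makes the range closed, and completeness of `f` makes its orthogonal complement
  -- trivial, so `T` is onto.
  have hclosed : IsClosed (T.range : Set H) := by
    rw [LinearMap.coe_range]
    exact hanti.isClosed_range T.uniformContinuous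
  have hrange : T.range = ⊤ := by
    have := hclosed.completeSpace_coe
    rw [← Submodule.orthogonal_eq_bot_iff, Submodule.eq_bot_iff]
    intro x hx
    exact hd x fun i => hx _ ⟨e i, hTe i⟩
  have hker : T.ker = ⊥ := LinearMap.ker_eq_bot.mpr hanti.injective
  exact ⟨e, ContinuousLinearEquiv.ofBijective T hker hrange, fun i => (hTe i).symm⟩

end RieszBasis

/-! ### Parseval for trigonometric polynomials -/

theorem inner_self_eq_coe_norm_sq {H : Type*} [NormedAddCommGroup H] [InnerProductSpace ℂ H]
    (x : H) : inner ℂ x x = ((‖x‖ ^ 2 : ℝ) : ℂ) := by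
  rw [inner_self_eq_norm_sq_to_K]; norm_cast

theorem MeasureTheory.L2.norm_sq_eq_integral {X : Type*} [MeasurableSpace X] {μ : Measure X}
    (F : Lp ℂ 2 μ) : ‖F‖ ^ 2 = ∫ x, ‖F x‖ ^ 2 ∂μ := by
  have h := L2.inner_def (𝕜 := ℂ) F F
  rw [inner_self_eq_coe_norm_sq] at h
  simp_rw [inner_self_eq_coe_norm_sq] at h
  rw [integral_complex_ofReal] at h
  exact Complex.ofReal_injective (by exact_mod_cast h)

theorem UnitAddCircle.volume_eq_haarAddCircle :
    (volume : Measure UnitAddCircle) = AddCircle.haarAddCircle := by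
  have := AddCircle.volume_eq_smul_haarAddCircle (T := 1)
  rwa [ENNReal.ofReal_one, one_smul] at this

theorem integral_haar_norm_sq_sum_fourier {T : ℝ} [Fact (0 < T)] (s : Finset ℤ) (a : ℤ → ℂ) :
    ∫ t : AddCircle T, ‖∑ n ∈ s, a n * fourier n t‖ ^ 2 ∂AddCircle.haarAddCircle
      = ∑ n ∈ s, ‖a n‖ ^ 2 := by
  have h1 : ‖∑ n ∈ s, a n • fourierLp (T := T) 2 n‖ ^ 2 = ∑ n ∈ s, ‖a n‖ ^ 2 := by
    have h := (orthonormal_fourier (T := T)).inner_sum a a s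
    rw [inner_self_eq_coe_norm_sq] at h
    have h2 : ∀ i, (starRingEnd ℂ) (a i) * a i = ((‖a i‖ ^ 2 : ℝ) : ℂ) := fun i => by
      rw [RCLike.conj_mul]; norm_cast
    simp_rw [h2] at h
    exact Complex.ofReal_injective (by exact_mod_cast h)
  rw [← h1, L2.norm_sq_eq_integral]
  refine integral_congr_ae ?_
  have h2 : ∀ n ∈ s, ∀ᵐ t ∂(AddCircle.haarAddCircle (T := T)),
      (a n • fourierLp (T := T) 2 n) t = a n * fourier n t := by
    intro n _
    filter_upwards [Lp.coeFn_smul (a n) (fourierLp (T := T) 2 n), coeFn_fourierLp (T := T) 2 n]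
      with t h h'
    rw [h, Pi.smul_apply, h', smul_eq_mul]
  filter_upwards [Lp.coeFn_finsetSum s (fun n => a n • fourierLp (T := T) 2 n),
    (Filter.eventually_all_finset s).mpr h2] with t ht ht'
  rw [ht, Finset.sum_apply, Finset.sum_congr rfl ht']

theorem integral_norm_sq_sum_fourier (s : Finset ℤ) (a : ℤ → ℂ) :
    ∫ t : UnitAddCircle, ‖∑ n ∈ s, a n * fourier n t‖ ^ 2 = ∑ n ∈ s, ‖a n‖ ^ 2 := by
  rw [UnitAddCircle.volume_eq_haarAddCircle, integral_haar_norm_sq_sum_fourier]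

theorem intervalIntegral_norm_sq_sum_fourier {T : ℝ} [hT : Fact (0 < T)] (α : ℝ) (s : Finset ℤ)
    (a : ℤ → ℂ) :
    ∫ x in α..α + T, ‖∑ n ∈ s, a n * fourier n (x : AddCircle T)‖ ^ 2
      = T * ∑ n ∈ s, ‖a n‖ ^ 2 := by
  rw [← integral_haar_norm_sq_sum_fourier (T := T), AddCircle.integral_haarAddCircle,
    ← AddCircle.intervalIntegral_preimage T α, smul_eq_mul, mul_inv_cancel_left₀ hT.out.ne']

/-! ### Riesz bounds and completeness on the circle, and transfer to the line -/

/-- The system `(fourier n)_{n ∈ Λ}` satisfies the lower Riesz inequality in `L²(S)`. -/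
def HasRieszLowerBound (S : Set UnitAddCircle) (Λ : Set ℤ) : Prop :=
  ∃ c : ℝ, 0 < c ∧ ∀ (s : Finset ℤ) (a : ℤ → ℂ), (∀ n ∈ s, n ∈ Λ) →
    c * ∑ n ∈ s, ‖a n‖ ^ 2 ≤ ∫ t in S, ‖∑ n ∈ s, a n * fourier n t‖ ^ 2

/-- The system `(fourier n)_{n ∈ Λ}` is complete in `L²(S)`. -/
def IsCompleteOn (S : Set UnitAddCircle) (Λ : Set ℤ) : Prop :=
  ∀ h : UnitAddCircle → ℂ, Measurable h → MemLp h 2 volume → (∀ᵐ t, t ∉ S → h t = 0) →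
    (∀ n ∈ Λ, ∫ t, fourier (-n) t * h t = 0) → h =ᵐ[volume] 0

theorem measurable_fourier (n : ℤ) : Measurable fun t : UnitAddCircle => (fourier n t : ℂ) :=
  (fourier n).continuous.measurable

theorem integrable_norm_sq_sum_fourier (s : Finset ℤ) (a : ℤ → ℂ) :
    Integrable fun t : UnitAddCircle => ‖∑ n ∈ s, a n * fourier n t‖ ^ 2 := by
  have hc : Continuous fun t : UnitAddCircle => ‖∑ n ∈ s, a n * fourier n t‖ ^ 2 := by fun_prop
  exact hc.integrable_of_hasCompactSupport (HasCompactSupport.of_compactSpace _)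

/-- For a function on the circle, integrating over a set amounts to integrating over its lift to
`(0, 1]`. -/
theorem setIntegral_lift {E : Type*} [NormedAddCommGroup E] [NormedSpace ℝ E]
    {S : Set ℝ} (hS : S ⊆ Ioo 0 1) (hmS : MeasurableSet S) {B : Set UnitAddCircle}
    (hmB : MeasurableSet B) (hB : ∀ x ∈ Ioc (0 : ℝ) 1, (x : UnitAddCircle) ∈ B ↔ x ∈ S)
    (F : UnitAddCircle → E) : ∫ t in B, F t = ∫ x in S, F (x : UnitAddCircle) := by
  rw [← integral_indicator hmB, ← UnitAddCircle.integral_preimage 0, ← integral_indicator hmS,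
    zero_add, ← integral_indicator measurableSet_Ioc]
  congr 1
  funext x
  by_cases hx : x ∈ Ioc (0 : ℝ) 1
  · rw [indicator_of_mem hx]
    by_cases hxS : x ∈ S
    · rw [indicator_of_mem hxS, indicator_of_mem ((hB x hx).mpr hxS)]
    · rw [indicator_of_notMem hxS, indicator_of_notMem (mt (hB x hx).mp hxS)]
  · rw [indicator_of_notMem hx, indicator_of_notMem fun h => hx (Ioo_subset_Ioc_self (hS h))]

theorem expFun_intCast (n : ℤ) (x : ℝ) : expFun n x = fourier n (x : UnitAddCircle) := by
  rw [fourier_coe_apply, expFun]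
  push_cast
  rw [div_one]

/-- A lower Riesz bound and completeness on the circle give a Riesz basis on the line. -/
theorem isExpRieszBasis_of_circle {S : Set ℝ} (hS : S ⊆ Ioo 0 1) (hmS : MeasurableSet S)
    {B : Set UnitAddCircle} (hmB : MeasurableSet B)
    (hB : ∀ x ∈ Ioc (0 : ℝ) 1, (x : UnitAddCircle) ∈ B ↔ x ∈ S) {Λ : Set ℤ}
    (hlow : HasRieszLowerBound B Λ) (hcompl : IsCompleteOn B Λ) :
    IsExpRieszBasis S (fun n : Λ => ((n : ℤ) : ℝ)) := by
  classical
  have hfin : IsFiniteMeasure (volume.restrict S) := by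
    refine ⟨?_⟩
    rw [Measure.restrict_apply_univ]
    exact (measure_mono hS).trans_lt (by simp)
  have hcont : ∀ n : ℤ, Continuous (expFun n) := fun n => by
    have : expFun n = fun x : ℝ => (fourier n (x : UnitAddCircle) : ℂ) :=
      funext (expFun_intCast n)
    rw [this]
    exact (fourier n).continuous.comp (AddCircle.continuous_mk' 1)
  have hmem : ∀ n : ℤ, MemLp (expFun n) 2 (volume.restrict S) := fun n =>
    MemLp.of_bound (hcont n).aestronglyMeasurable 1 (Filter.Eventually.of_forall fun x => by
      rw [expFun_intCast, fourier_apply, Circle.norm_coe])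
  let f : Λ → Lp ℂ 2 (volume.restrict S) := fun n => (hmem n).toLp
  have hf : ∀ n : Λ, f n =ᵐ[volume.restrict S] expFun ((n : ℤ) : ℝ) := fun n =>
    (hmem n).coeFn_toLp
  have hnorm : ∀ (s : Finset Λ) (c : Λ → ℂ), ∃ (s' : Finset ℤ) (a : ℤ → ℂ), (∀ n ∈ s', n ∈ Λ) ∧
      ∑ i ∈ s, ‖c i‖ ^ 2 = ∑ n ∈ s', ‖a n‖ ^ 2 ∧
      ‖∑ i ∈ s, c i • f i‖ ^ 2 = ∫ t in B, ‖∑ n ∈ s', a n * fourier n t‖ ^ 2 := by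
    intro s c
    let a : ℤ → ℂ := fun n => if h : n ∈ Λ then c ⟨n, h⟩ else 0
    have ha : ∀ i : Λ, a i = c i := fun i => by simp [a]
    refine ⟨s.map (Function.Embedding.subtype _), a, ?_, ?_, ?_⟩
    · intro n hn
      obtain ⟨i, _, rfl⟩ := Finset.mem_map.mp hn
      exact i.2
    · simp [Finset.sum_map, ha]
    · rw [setIntegral_lift hS hmS hmB hB, L2.norm_sq_eq_integral]
      refine integral_congr_ae ?_
      have h2 : ∀ n ∈ s, ∀ᵐ t ∂(volume.restrict S),
          (c n • f n) t = c n * fourier (n : ℤ) (t : UnitAddCircle) := by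
        intro n _
        filter_upwards [Lp.coeFn_smul (c n) (f n), hf n] with t h h'
        rw [h, Pi.smul_apply, h', smul_eq_mul, expFun_intCast]
      filter_upwards [Lp.coeFn_finsetSum s (fun n => c n • f n),
        (Filter.eventually_all_finset s).mpr h2] with t ht ht'
      rw [ht, Finset.sum_apply, Finset.sum_congr rfl ht', Finset.sum_map]
      simp [ha]
  obtain ⟨A, hA, hlow⟩ := hlow
  have : Fact ((2 : ENNReal) ≠ ⊤) := ⟨by norm_num⟩
  refine ⟨f, hf, isRieszBasis_of_bounds (A := A) (B := 1) hA ?_ ?_ ?_⟩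
  · intro s c
    obtain ⟨s', a, hs', h1, h2⟩ := hnorm s c
    rw [h1, h2]
    exact hlow s' a hs'
  · intro s c
    obtain ⟨s', a, hs', h1, h2⟩ := hnorm s c
    -- The upper constant is 1: the integral over `B` is at most the integral over the whole circle,
    -- which Parseval evaluates.
    rw [h1, h2, one_mul, ← integral_norm_sq_sum_fourier]
    exact setIntegral_le_integral (integrable_norm_sq_sum_fourier s' a)
      (Filter.Eventually.of_forall fun t => by positivity)
  · intro g hg
    obtain ⟨g', hg'm, hgg'⟩ := Lp.aestronglyMeasurable g
    have hg'L : MemLp g' 2 (volume.restrict S) := (memLp_congr_ae hgg').mp (Lp.memLp g)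
    -- To use completeness on the circle, `g` is extended by zero off `S` and carried over by the
    -- identification with `(0, 1]`.
    let H : ℝ → ℂ := S.indicator g'
    have hHm : Measurable H := hg'm.measurable.indicator hmS
    let e := AddCircle.measurableEquivIoc (1 : ℝ) 0
    let h : UnitAddCircle → ℂ := fun t => H (e t)
    have hhm : Measurable h := hHm.comp (measurable_subtype_coe.comp e.measurable)
    have hhx : ∀ x ∈ Ioc (0 : ℝ) 1, h (x : UnitAddCircle) = H x := by
      intro x hx
      have hx' : x ∈ Ioc (0 : ℝ) (0 + 1) := by simpa using hx
      have : e (x : UnitAddCircle) = ⟨x, hx'⟩ := by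
        have h1 : e.symm ⟨x, hx'⟩ = (x : UnitAddCircle) := rfl
        rw [← h1, e.apply_symm_apply]
      simp only [h, this]
    have hmk := UnitAddCircle.measurePreserving_mk 0
    have hcomp : (h ∘ ((↑) : ℝ → UnitAddCircle)) =ᵐ[volume.restrict (Ioc (0 : ℝ) (0 + 1))] H := by
      filter_upwards [ae_restrict_mem measurableSet_Ioc] with x hx
      exact hhx x (by simpa using hx)
    have hH2 : MemLp H 2 volume := (memLp_indicator_iff_restrict hmS).mpr hg'L
    have hh2 : MemLp h 2 volume := by
      rw [← hmk.map_eq, memLp_map_measure_iff hhm.aestronglyMeasurable hmk.measurable.aemeasurable]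
      exact (memLp_congr_ae hcomp).mpr (hH2.restrict _)
    have hoff : ∀ t, t ∉ B → h t = 0 := by
      intro t ht
      have hx := (e t).2
      have hxt : ((e t : ℝ) : UnitAddCircle) = t := e.symm_apply_apply t
      have hx' : (e t : ℝ) ∈ Ioc (0 : ℝ) 1 := by simpa using hx
      refine indicator_of_notMem (fun h => ht ?_) _
      rw [← hxt]
      exact (hB _ hx').mpr h
    have hzero := hcompl h hhm hh2 (Filter.Eventually.of_forall hoff) ?_
    · have h1 : ∀ᵐ x : ℝ ∂volume.restrict (Ioc (0 : ℝ) (0 + 1)), h (x : UnitAddCircle) = 0 :=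
        hmk.quasiMeasurePreserving.ae hzero
      have hle : volume.restrict S ≤ volume.restrict (Ioc (0 : ℝ) (0 + 1)) :=
        Measure.restrict_mono (fun x hx => by simpa using Ioo_subset_Ioc_self (hS hx)) le_rfl
      rw [Lp.eq_zero_iff_ae_eq_zero]
      filter_upwards [hgg', ae_restrict_mem hmS, ae_mono hle h1] with x hx hxS hx1
      rw [hhx x (Ioo_subset_Ioc_self (hS hxS))] at hx1
      rw [hx, Pi.zero_apply, ← hx1]
      exact (indicator_of_mem hxS _).symm
    · intro n hn
      have h1 := hg ⟨n, hn⟩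
      rw [L2.inner_def] at h1
      have h2 : ∫ t, fourier (-n) t * h t = ∫ t in B, fourier (-n) t * h t := by
        rw [setIntegral_eq_integral_of_forall_compl_eq_zero]
        intro t ht
        rw [hoff t ht, mul_zero]
      rw [h2, setIntegral_lift hS hmS hmB hB, ← h1]
      refine integral_congr_ae ?_
      filter_upwards [hgg', ae_restrict_mem hmS, hf ⟨n, hn⟩] with x hx hxS hfx
      rw [hhx x (Ioo_subset_Ioc_self (hS hxS)), hfx, hx, expFun_intCast, fourier_neg]
      simp [H, indicator_of_mem hxS, mul_comm]

/-! ### Vandermonde systems and back-substitution -/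

/-- The `x j` are the coefficients of a polynomial of degree less than `W.card` that has `W.card`
distinct roots `ζ l`. -/
theorem eq_zero_of_vandermonde {ι : Type*} {N : ℕ} {ζ : ι → ℂ} (hζ : Function.Injective ζ)
    (W : Finset ι) (x : Fin N → ℂ) (hx : ∀ j : Fin N, W.card ≤ j → x j = 0)
    (hW : ∀ l ∈ W, ∑ j, x j * ζ l ^ (j : ℕ) = 0) : x = 0 := by
  classical
  let p : Polynomial ℂ := ∑ j : Fin N, Polynomial.C (x j) * Polynomial.X ^ (j : ℕ)
  have hcoeff : ∀ j : Fin N, p.coeff j = x j := by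
    intro j
    simp only [p, Polynomial.finsetSum_coeff, Polynomial.coeff_C_mul_X_pow]
    rw [Finset.sum_eq_single j]
    · simp
    · intro i _ hij
      rw [if_neg fun h => hij (Fin.ext h.symm)]
    · simp
  have hp : p = 0 := by
    refine Polynomial.eq_zero_of_degree_lt_of_eval_finset_eq_zero (W.image ζ) ?_ ?_
    · rw [Finset.card_image_of_injective _ hζ]
      refine (Polynomial.degree_lt_iff_coeff_zero _ _).mpr fun m hm => ?_
      by_cases hmN : m < N
      · exact (hcoeff ⟨m, hmN⟩).trans (hx ⟨m, hmN⟩ hm)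
      · simp only [p, Polynomial.finsetSum_coeff, Polynomial.coeff_C_mul_X_pow]
        refine Finset.sum_eq_zero fun j _ => if_neg ?_
        have := j.2
        omega
    · intro z hz
      obtain ⟨l, hl, rfl⟩ := Finset.mem_image.mp hz
      simpa [p, Polynomial.eval_finsetSum] using hW l hl
  funext j
  rw [← hcoeff j, hp]
  simp

theorem eq_zero_of_vandermonde_transpose {ι : Type*} {ζ : ι → ℂ} (hζ : Function.Injective ζ)
    (W : Finset ι) (y : ι → ℂ) (hW : ∀ j < W.card, ∑ l ∈ W, y l * ζ l ^ j = 0) :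
    ∀ l ∈ W, y l = 0 := by
  let e : Fin W.card ≃ W := W.equivFin.symm
  have h := Matrix.eq_zero_of_forall_pow_sum_mul_pow_eq_zero (f := fun i => ζ (e i))
    (v := fun i => y (e i)) (fun i j hij => e.injective (Subtype.ext (hζ hij))) fun j => by
      have := hW j j.2
      rw [← Finset.sum_coe_sort, ← e.sum_comp] at this
      exact this
  intro l hl
  have := congrFun h (e.symm ⟨l, hl⟩)
  simpa using this

/-- For fixed `W`, the Vandermonde values on `W` together with the coordinates `j ≥ W.card`
determine `x`, and an injective linear map in finite dimension is bounded below. There are finitely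
many `W`, so the sum of the constants serves them all. This uniformity is needed because the fiber
set varies with the base point. -/
theorem exists_vandermonde_bound {ι : Type*} [Fintype ι] (N : ℕ) {ζ : ι → ℂ}
    (hζ : Function.Injective ζ) :
    ∃ C : ℝ, 0 ≤ C ∧ ∀ (W : Finset ι) (x : Fin N → ℂ) (k : Fin N), ‖x k‖ ^ 2 ≤
      C * (∑ l ∈ W, ‖∑ j, x j * ζ l ^ (j : ℕ)‖ ^ 2 +
        ∑ j : Fin N, if W.card ≤ j then ‖x j‖ ^ 2 else 0) := by
  classical
  have hone : ∀ W : Finset ι, ∃ C : ℝ, 0 ≤ C ∧ ∀ (x : Fin N → ℂ) (k : Fin N), ‖x k‖ ^ 2 ≤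
      C * (∑ l ∈ W, ‖∑ j, x j * ζ l ^ (j : ℕ)‖ ^ 2 +
        ∑ j : Fin N, if W.card ≤ j then ‖x j‖ ^ 2 else 0) := by
    intro W
    let A : (Fin N → ℂ) →ₗ[ℂ] (W → ℂ) × (Fin N → ℂ) :=
      { toFun := fun x => (fun l => ∑ j, x j * ζ l ^ (j : ℕ), fun j => if W.card ≤ j then x j else 0)
        map_add' := fun x y => by
          refine Prod.ext (funext fun l => ?_) (funext fun j => ?_)
          · simp [add_mul, Finset.sum_add_distrib]
          · by_cases h : W.card ≤ j <;> simp [h]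
        map_smul' := fun c x => by
          refine Prod.ext (funext fun l => ?_) (funext fun j => ?_)
          · simp [Finset.mul_sum, mul_assoc]
          · by_cases h : W.card ≤ j <;> simp [h] }
    have hker : LinearMap.ker A = ⊥ := by
      rw [LinearMap.ker_eq_bot']
      intro x hx
      refine eq_zero_of_vandermonde hζ W x (fun j hj => ?_) fun l hl => ?_
      · have := congrFun (congrArg Prod.snd hx) j
        simpa [A, hj] using this
      · exact congrFun (congrArg Prod.fst hx) ⟨l, hl⟩
    obtain ⟨K, _, hK⟩ := A.exists_antilipschitzWith hker
    refine ⟨K ^ 2, by positivity, fun x k => ?_⟩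
    set R := ∑ l ∈ W, ‖∑ j, x j * ζ l ^ (j : ℕ)‖ ^ 2 +
        ∑ j : Fin N, if W.card ≤ j then ‖x j‖ ^ 2 else 0 with hR
    have h1 : ∀ j : Fin N, 0 ≤ if W.card ≤ j then ‖x j‖ ^ 2 else 0 := fun j => by
      split_ifs <;> positivity
    have h2 : 0 ≤ ∑ l ∈ W, ‖∑ j, x j * ζ l ^ (j : ℕ)‖ ^ 2 :=
      Finset.sum_nonneg fun l _ => by positivity
    have h3 : 0 ≤ ∑ j : Fin N, if W.card ≤ j then ‖x j‖ ^ 2 else 0 :=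
      Finset.sum_nonneg fun j _ => h1 j
    have hAx : ‖A x‖ ≤ Real.sqrt R := by
      rw [Prod.norm_def, max_le_iff, pi_norm_le_iff_of_nonneg (Real.sqrt_nonneg _),
        pi_norm_le_iff_of_nonneg (Real.sqrt_nonneg _)]
      constructor
      · intro l
        refine Real.le_sqrt_of_sq_le ?_
        have := Finset.single_le_sum (f := fun l => ‖∑ j, x j * ζ l ^ (j : ℕ)‖ ^ 2)
          (fun l _ => by positivity) l.2
        exact this.trans (le_add_of_nonneg_right h3)
      · intro j
        refine Real.le_sqrt_of_sq_le ?_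
        have := Finset.single_le_sum (fun j _ => h1 j) (Finset.mem_univ j)
        refine le_trans ?_ (this.trans (le_add_of_nonneg_left h2))
        by_cases h : W.card ≤ j <;> simp [A, h]
    have hx : ‖x‖ ≤ K * ‖A x‖ := by
      have := hK.le_mul_dist x 0
      simpa using this
    have hxk : ‖x k‖ ≤ K * Real.sqrt R :=
      (norm_le_pi_norm x k).trans (hx.trans (mul_le_mul_of_nonneg_left hAx K.2))
    calc ‖x k‖ ^ 2 ≤ (K * Real.sqrt R) ^ 2 := by gcongr
      _ = K ^ 2 * R := by rw [mul_pow, Real.sq_sqrt (add_nonneg h2 h3)]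
  choose C hC0 hC using hone
  refine ⟨∑ W, C W, Finset.sum_nonneg fun W _ => hC0 W, fun W x k => (hC W x k).trans ?_⟩
  refine mul_le_mul_of_nonneg_right
    (Finset.single_le_sum (fun W _ => hC0 W) (Finset.mem_univ W)) ?_
  refine add_nonneg (Finset.sum_nonneg fun l _ => by positivity) (Finset.sum_nonneg fun j _ => ?_)
  split_ifs <;> positivity

/-- Back-substitution: each `E k` is bounded through the later ones, so the tail is bounded first
and then the head. -/
theorem exists_sum_bound_of_triangular {N : ℕ} (D : Fin N → ℝ) (hD : ∀ k, 0 ≤ D k) :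
    ∃ K : ℝ, 0 ≤ K ∧ ∀ (E : Fin N → ℝ) (I : ℝ),
      (∀ k, E k ≤ D k * (I + ∑ j, if k < j then E j else 0)) → ∑ j, E j ≤ K * I := by
  induction N with
  | zero => exact ⟨0, le_rfl, fun E I _ => by simp⟩
  | succ N ih =>
    obtain ⟨K, hK, h⟩ := ih (fun k => D k.succ) fun k => hD _
    -- The tail contributes `K * I`, and hence the head at most `D 0 * (I + K * I)`.
    refine ⟨D 0 * (1 + K) + K, by have := hD 0; positivity, fun E I hE => ?_⟩
    have h1 := h (fun k => E k.succ) I fun k => by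
      simpa [Fin.sum_univ_succ] using hE k.succ
    have h2 := hE 0
    simp only [Fin.sum_univ_succ, lt_irrefl, if_false, Fin.succ_pos, if_true, zero_add] at h2 ⊢
    nlinarith [mul_le_mul_of_nonneg_left h1 (hD 0)]

/-! ### Residue classes and characters of the circle -/

theorem injOn_residue {N : ℕ} [NeZero N] (j : ℤ) : Function.Injective fun m : ℤ => N * m + j := by
  intro m m' h
  have hN : (N : ℤ) ≠ 0 := Int.natCast_ne_zero.mpr (NeZero.ne N)
  exact mul_left_cancel₀ hN (add_right_cancel h)

/-- Splitting a sum over integers into residue classes modulo `N`. -/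
theorem Finset.sum_int_eq_sum_residue {N : ℕ} [NeZero N] {M : Type*} [AddCommMonoid M]
    (s : Finset ℤ) (g : ℤ → M) :
    ∑ n ∈ s, g n = ∑ j : Fin N,
      ∑ m ∈ s.preimage (fun m : ℤ => N * m + (j : ℕ)) (injOn_residue _).injOn,
        g (N * m + (j : ℕ)) := by
  rw [Finset.sum_sigma']
  have hN : (0 : ℤ) < N := Int.natCast_pos.mpr (NeZero.pos N)
  symm
  refine Finset.sum_bij (fun p _ => N * p.2 + (p.1 : ℕ)) ?_ ?_ ?_ ?_
  · intro p hp
    simpa using hp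
  · rintro ⟨j, m⟩ _ ⟨j', m'⟩ _ h
    have hj : (j : ℕ) = j' := by
      have := congrArg (· % (N : ℤ)) h
      simp only [Int.mul_add_emod_self_left] at this
      rw [Int.emod_eq_of_lt (by positivity) (by exact_mod_cast j.2),
        Int.emod_eq_of_lt (by positivity) (by exact_mod_cast j'.2)] at this
      exact_mod_cast this
    obtain rfl : j = j' := Fin.ext hj
    obtain rfl : m = m' := injOn_residue (N := N) _ h
    rfl
  · intro n hn
    have h0 := Int.emod_nonneg n hN.ne'
    have h1 := Int.emod_lt_of_pos n hN
    have h2 := Int.mul_ediv_add_emod n N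
    have h3 : ((n % N).toNat : ℤ) = n % N := Int.toNat_of_nonneg h0
    have h4 : (N : ℤ) * (n / N) + ((n % N).toNat : ℤ) = n := by rw [h3, h2]
    refine ⟨⟨⟨(n % N).toNat, by omega⟩, n / N⟩, ?_, h4⟩
    simpa [h4, -Int.ofNat_toNat] using hn
  · intro p _
    rfl

theorem fourier_add_arg (n : ℤ) (x y : UnitAddCircle) :
    (fourier n (x + y) : ℂ) = fourier n x * fourier n y := by
  simp only [fourier_apply, zsmul_add, AddCircle.toCircle_add, Circle.coe_mul]

theorem fourier_mul_zsmul (k m : ℤ) (x : UnitAddCircle) :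
    (fourier (k * m) x : ℂ) = fourier m (k • x) := by
  simp only [fourier_apply, smul_smul, mul_comm]

theorem fourier_mul_natCast (n : ℤ) (j : ℕ) (x : UnitAddCircle) :
    (fourier (n * j) x : ℂ) = fourier n x ^ j := by
  induction j with
  | zero => simp
  | succ j ih => rw [Nat.cast_succ, mul_add, mul_one, fourier_add, ih, pow_succ]

theorem norm_fourier_apply (n : ℤ) (x : UnitAddCircle) : ‖(fourier n x : ℂ)‖ = 1 := by
  rw [fourier_apply, Circle.norm_coe]

theorem fourier_injective {n : ℤ} (hn : n = 1 ∨ n = -1) :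
    Function.Injective fun x : UnitAddCircle => (fourier n x : ℂ) := by
  intro x y h
  have h1 : (fourier 1 x : ℂ) = fourier 1 y := by
    rcases hn with rfl | rfl
    · exact h
    · simp only [fourier_neg] at h
      exact star_injective h
  simp only [fourier_one] at h1
  exact AddCircle.injective_toCircle one_ne_zero (Subtype.ext h1)

/-! ### Combining frequencies along multiplication by `N`: the lower bound -/

section Combination

variable {N : ℕ} [NeZero N]

theorem zsmul_toAddCircle (l : ZMod N) : (N : ℤ) • ZMod.toAddCircle l = 0 := by
  rw [← map_zsmul]
  simp

theorem exists_eq_toAddCircle {x : UnitAddCircle} (hx : (N : ℤ) • x = 0) :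
    ∃ l : ZMod N, x = ZMod.toAddCircle l := by
  obtain ⟨r, rfl⟩ := QuotientAddGroup.mk_surjective x
  have h : (((N : ℤ) • r : ℝ) : UnitAddCircle) = 0 := hx
  obtain ⟨m, hm⟩ := (AddCircle.coe_eq_zero_iff 1).mp h
  have hN : (N : ℝ) ≠ 0 := NeZero.ne _
  refine ⟨(m : ZMod N), ?_⟩
  rw [ZMod.toAddCircle_intCast]
  have : r = m / N := by
    rw [eq_div_iff hN]
    simpa [mul_comm] using hm.symm
  rw [this]

open scoped Classical in
/-- The indices `l` modulo `N` for which `t + l / N` lies in `S`. -/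
noncomputable def fiberIndices (N : ℕ) [NeZero N] (S : Set UnitAddCircle) (t : UnitAddCircle) :
    Finset (ZMod N) :=
  Finset.univ.filter fun l => t + ZMod.toAddCircle l ∈ S

theorem mem_fiberIndices {S : Set UnitAddCircle} {t : UnitAddCircle} {l : ZMod N} :
    l ∈ fiberIndices N S t ↔ t + ZMod.toAddCircle l ∈ S := by
  simp [fiberIndices]

/-- Moving the base point within its fiber only translates the index set, so the count depends on `N
• t` alone. -/
theorem card_fiberIndices_add (S : Set UnitAddCircle) (t : UnitAddCircle) (k : ZMod N) :
    (fiberIndices N S (t + ZMod.toAddCircle k)).card = (fiberIndices N S t).card := by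
  refine Finset.card_bij (fun l _ => k + l) ?_ ?_ ?_
  · intro l hl
    rw [mem_fiberIndices] at hl ⊢
    rwa [map_add, ← add_assoc]
  · intro l _ l' _ h
    exact add_left_cancel h
  · intro l hl
    refine ⟨l - k, ?_, add_sub_cancel k l⟩
    rw [mem_fiberIndices] at hl ⊢
    rwa [add_assoc, ← map_add, add_sub_cancel]

theorem measurePreserving_zsmul_natCast :
    MeasurePreserving (fun t : UnitAddCircle => (N : ℤ) • t) volume volume :=
  Measure.measurePreserving_zsmul volume (Int.natCast_ne_zero.mpr (NeZero.ne N))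

theorem integral_comp_zsmul {E : Type*} [NormedAddCommGroup E] [NormedSpace ℝ E]
    {F : UnitAddCircle → E} (hF : AEStronglyMeasurable F volume) :
    ∫ t, F ((N : ℤ) • t) = ∫ t, F t := by
  have h := measurePreserving_zsmul_natCast (N := N)
  conv_rhs => rw [← h.map_eq]
  rw [integral_map h.measurable.aemeasurable]
  rwa [h.map_eq]

theorem integrable_comp_zsmul {E : Type*} [NormedAddCommGroup E] (N : ℕ) [NeZero N]
    {F : UnitAddCircle → E} (hF : Integrable F volume) :
    Integrable (fun t => F ((N : ℤ) • t)) volume :=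
  (measurePreserving_zsmul_natCast (N := N)).integrable_comp_of_integrable hF

/-- Where `N • t` lies in `B k`, the fiber has more than `k` points in `S`, so the Vandermonde bound
controls the piece `f k` by the values of the sum on `S` and by pieces of index at least the fiber
count, all larger than `k`. Integration gives a triangular system for the energies of the pieces. -/
theorem hasRieszLowerBound_combine {S : Set UnitAddCircle} (hS : MeasurableSet S)
    {B : Fin N → Set UnitAddCircle} (hBm : ∀ j, MeasurableSet (B j))
    (hB : ∀ (j : Fin N) t, (N : ℤ) • t ∈ B j ↔ (j : ℕ) < (fiberIndices N S t).card)
    {Λ : Fin N → Set ℤ} (h : ∀ j, HasRieszLowerBound (B j) (Λ j)) :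
    HasRieszLowerBound S {n | ∃ j : Fin N, ∃ m ∈ Λ j, n = N * m + (j : ℕ)} := by
  classical
  have hN : (0 : ℤ) < N := Int.natCast_pos.mpr (NeZero.pos N)
  choose c hc0 hc using h
  obtain ⟨C, hC0, hC⟩ := exists_vandermonde_bound N (ζ := fun l : ZMod N =>
    (fourier 1 (ZMod.toAddCircle l) : ℂ))
    ((fourier_injective (Or.inl rfl)).comp (ZMod.toAddCircle_injective N))
  -- The Riesz bound on `B k` costs `1 / c k`; averaging over fibers gives `C * (N * I + R)`, which
  -- is at most `(C * N + C) * (I + R)`, with `R` the sum of the later energies.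
  obtain ⟨K, hK0, hK⟩ := exists_sum_bound_of_triangular (fun k => (C * N + C) / c k)
    fun k => by have := hc0 k; positivity
  refine ⟨1 / (K + 1), by positivity, fun s a hs => ?_⟩
  let σ : Fin N → Finset ℤ := fun j =>
    s.preimage (fun m : ℤ => N * m + (j : ℕ)) (injOn_residue _).injOn
  let b : Fin N → ℤ → ℂ := fun j m => a (N * m + (j : ℕ))
  let f : Fin N → UnitAddCircle → ℂ := fun j u => ∑ m ∈ σ j, b j m * fourier m u
  let G : UnitAddCircle → ℂ := fun t => ∑ n ∈ s, a n * fourier n t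
  let E : Fin N → ℝ := fun j => ∑ m ∈ σ j, ‖b j m‖ ^ 2
  have hσ : ∀ j, ∀ m ∈ σ j, m ∈ Λ j := by
    intro j m hm
    obtain ⟨j', m', hm', he⟩ := hs _ (Finset.mem_preimage.mp hm)
    have hj : (j : ℕ) = j' := by
      have := congrArg (· % (N : ℤ)) he
      simp only [Int.mul_add_emod_self_left] at this
      rw [Int.emod_eq_of_lt (by positivity) (by exact_mod_cast j.2),
        Int.emod_eq_of_lt (by positivity) (by exact_mod_cast j'.2)] at this
      exact_mod_cast this
    obtain rfl : j = j' := Fin.ext hj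
    obtain rfl : m = m' := injOn_residue (N := N) _ he
    exact hm'
  have hG : ∀ t, G t = ∑ j : Fin N, fourier (j : ℕ) t * f j ((N : ℤ) • t) := by
    intro t
    simp only [G]
    rw [Finset.sum_int_eq_sum_residue (N := N)]
    refine Finset.sum_congr rfl fun j _ => ?_
    simp only [f, Finset.mul_sum]
    refine Finset.sum_congr rfl fun m _ => ?_
    rw [fourier_add, fourier_mul_zsmul]
    ring
  have hGl : ∀ t (l : ZMod N), G (t + ZMod.toAddCircle l) = ∑ j : Fin N,
      (fourier (j : ℕ) t * f j ((N : ℤ) • t)) * fourier 1 (ZMod.toAddCircle l) ^ (j : ℕ) := by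
    intro t l
    rw [hG]
    refine Finset.sum_congr rfl fun j _ => ?_
    rw [fourier_add_arg, zsmul_add, zsmul_toAddCircle, add_zero, ← fourier_mul_natCast, one_mul]
    ring
  -- The energy on the part of the fiber through `t` lying in `S`; by translation invariance it
  -- integrates to `N` times the energy on `S`.
  let Φ : UnitAddCircle → ℝ := fun t => ∑ l : ZMod N,
    S.indicator (fun t => ‖G t‖ ^ 2) (t + ZMod.toAddCircle l)
  have hGint : Integrable fun t => S.indicator (fun t => ‖G t‖ ^ 2) t :=
    (integrable_norm_sq_sum_fourier s a).indicator hS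
  have hΦint : Integrable Φ := integrable_finsetSum _ fun l _ => hGint.comp_add_right _
  have hΦ0 : ∀ t, 0 ≤ Φ t := fun t =>
    Finset.sum_nonneg fun l _ => indicator_nonneg (fun t _ => by positivity) _
  have hΦ : ∫ t, Φ t = N * ∫ t in S, ‖G t‖ ^ 2 := by
    rw [integral_finsetSum _ fun l _ => hGint.comp_add_right _]
    simp only [integral_add_right_eq_self (fun t => S.indicator (fun t => ‖G t‖ ^ 2) t),
      integral_indicator hS]
    simp [ZMod.card]
  have hfint : ∀ j, Integrable fun u => ‖f j u‖ ^ 2 := fun j =>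
    integrable_norm_sq_sum_fourier (σ j) (b j)
  have hfNint : ∀ j, Integrable fun t => ‖f j ((N : ℤ) • t)‖ ^ 2 := fun j =>
    integrable_comp_zsmul (F := fun u => ‖f j u‖ ^ 2) N (hfint j)
  have hfE : ∀ j, ∫ t, ‖f j ((N : ℤ) • t)‖ ^ 2 = E j := fun j => by
    rw [integral_comp_zsmul (F := fun u => ‖f j u‖ ^ 2) (hfint j).aestronglyMeasurable,
      integral_norm_sq_sum_fourier (σ j) (b j)]
  have hpt : ∀ (k : Fin N) t, (B k).indicator (fun u => ‖f k u‖ ^ 2) ((N : ℤ) • t) ≤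
      C * (Φ t + ∑ j : Fin N, if k < j then ‖f j ((N : ℤ) • t)‖ ^ 2 else 0) := by
    intro k t
    have hsum0 : 0 ≤ ∑ j : Fin N, if k < j then ‖f j ((N : ℤ) • t)‖ ^ 2 else 0 :=
      Finset.sum_nonneg fun j _ => by split_ifs <;> positivity
    by_cases hkt : (N : ℤ) • t ∈ B k
    · rw [indicator_of_mem hkt]
      have hcard := (hB k t).mp hkt
      have h1 := hC (fiberIndices N S t) (fun j => fourier (j : ℕ) t * f j ((N : ℤ) • t)) k
      simp only [norm_mul, norm_fourier_apply, one_mul] at h1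
      refine h1.trans (mul_le_mul_of_nonneg_left (add_le_add ?_ ?_) hC0)
      · simp only [Φ]
        refine le_trans (le_of_eq ?_) (Finset.sum_le_univ_sum_of_nonneg
          (s := fiberIndices N S t) fun l => indicator_nonneg (fun t _ => by positivity) _)
        refine Finset.sum_congr rfl fun l hl => ?_
        rw [indicator_of_mem (mem_fiberIndices.mp hl), hGl]
      · refine Finset.sum_le_sum fun j _ => ?_
        by_cases hj : (fiberIndices N S t).card ≤ j
        -- An index treated as data satisfies `j ≥ card > k`, which makes the system strictly
        -- triangular.
        · rw [if_pos hj, if_pos (Fin.lt_def.mpr (hcard.trans_le hj))]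
        · rw [if_neg hj]
          split_ifs <;> positivity
    · rw [indicator_of_notMem hkt]
      exact mul_nonneg hC0 (add_nonneg (hΦ0 t) hsum0)
  have hE0 : ∀ j, 0 ≤ E j := fun j => Finset.sum_nonneg fun m _ => by positivity
  have hI0 : 0 ≤ ∫ t in S, ‖G t‖ ^ 2 := integral_nonneg fun t => by positivity
  have hrec : ∀ k, E k ≤ (C * N + C) / c k *
      ((∫ t in S, ‖G t‖ ^ 2) + ∑ j, if k < j then E j else 0) := by
    intro k
    have h1 : c k * E k ≤ ∫ u in B k, ‖f k u‖ ^ 2 := hc k (σ k) (b k) (hσ k)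
    have hind := (hfint k).indicator (hBm k)
    have hint : ∀ j ∈ (Finset.univ : Finset (Fin N)),
        Integrable fun t => if k < j then ‖f j ((N : ℤ) • t)‖ ^ 2 else 0 := fun j _ => by
      split_ifs
      · exact hfNint j
      · exact integrable_zero _ _ _
    have h2 : ∫ u in B k, ‖f k u‖ ^ 2 ≤ C * (N * (∫ t in S, ‖G t‖ ^ 2) +
        ∑ j, if k < j then E j else 0) := by
      rw [← integral_indicator (hBm k), ← integral_comp_zsmul (N := N) hind.aestronglyMeasurable]
      refine (integral_mono (integrable_comp_zsmul N hind)
        ((hΦint.add (integrable_finsetSum _ hint)).const_mul C) (hpt k)).trans_eq ?_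
      rw [integral_const_mul]
      congr 1
      rw [integral_add' hΦint (integrable_finsetSum _ hint), hΦ, integral_finsetSum _ hint]
      congr 1
      refine Finset.sum_congr rfl fun j _ => ?_
      split_ifs
      · exact hfE j
      · exact integral_zero _ _
    have h3 : 0 ≤ ∑ j, if k < j then E j else 0 := Finset.sum_nonneg fun j _ => by
      split_ifs
      · exact hE0 j
      · exact le_rfl
    rw [div_mul_eq_mul_div, le_div_iff₀ (hc0 k), mul_comm]
    have hN1 : (1 : ℝ) ≤ N := by exact_mod_cast NeZero.one_le
    have h4 : 0 ≤ C * ∫ t in S, ‖G t‖ ^ 2 := mul_nonneg hC0 hI0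
    have h5 : 0 ≤ C * N * ∑ j, if k < j then E j else 0 := by positivity
    nlinarith
  have hfinal := hK E _ hrec
  have hsumE : ∑ n ∈ s, ‖a n‖ ^ 2 = ∑ j, E j := Finset.sum_int_eq_sum_residue s _
  rw [hsumE, div_mul_eq_mul_div, one_mul, div_le_iff₀ (by positivity), mul_comm]
  change ∑ j, E j ≤ (K + 1) * ∫ t in S, ‖G t‖ ^ 2
  linarith

end Combination

/-! ### Combining frequencies along multiplication by `N`: completeness -/

theorem memLp_fourier_mul (n : ℤ) {h : UnitAddCircle → ℂ} (hm : Measurable h)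
    (hh : MemLp h 2 volume) : MemLp (fun t => fourier n t * h t) 2 volume :=
  hh.congr_norm ((measurable_fourier n).mul hm).aestronglyMeasurable
    (Filter.Eventually.of_forall fun t => by rw [norm_mul, norm_fourier_apply, one_mul])

theorem integrable_fourier_mul (n : ℤ) {h : UnitAddCircle → ℂ} (hm : Measurable h)
    (hh : MemLp h 2 volume) : Integrable (fun t => fourier n t * h t) volume :=
  (memLp_fourier_mul n hm hh).integrable (by norm_num)

section Combination

variable {N : ℕ} [NeZero N]

theorem ae_comp_add_right (x : UnitAddCircle) {p : UnitAddCircle → Prop} (hp : ∀ᵐ u, p u) :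
    ∀ᵐ t, p (t + x) :=
  (measurePreserving_add_right volume x).quasiMeasurePreserving.ae hp

theorem ae_comp_zsmul (N : ℕ) [NeZero N] {p : UnitAddCircle → Prop} (hp : ∀ᵐ u, p u) :
    ∀ᵐ t : UnitAddCircle, p ((N : ℤ) • t) :=
  (measurePreserving_zsmul_natCast (N := N)).quasiMeasurePreserving.ae hp

/-- A section of multiplication by `N` on the circle. -/
noncomputable def divSection (N : ℕ) (u : UnitAddCircle) : UnitAddCircle :=
  (((AddCircle.measurableEquivIoc (1 : ℝ) 0 u : ℝ) / N : ℝ) : UnitAddCircle)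

theorem measurable_divSection (N : ℕ) : Measurable (divSection N) :=
  AddCircle.measurable_mk'.comp ((measurable_subtype_coe.comp
    (AddCircle.measurableEquivIoc (1 : ℝ) 0).measurable).div_const _)

theorem zsmul_divSection (u : UnitAddCircle) : (N : ℤ) • divSection N u = u := by
  have hN : (N : ℝ) ≠ 0 := NeZero.ne _
  have h1 : (((AddCircle.measurableEquivIoc (1 : ℝ) 0 u : ℝ)) : UnitAddCircle) = u :=
    (AddCircle.measurableEquivIoc (1 : ℝ) 0).symm_apply_apply u
  conv_rhs => rw [← h1]
  rw [divSection, ← AddCircle.coe_zsmul]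
  congr 1
  rw [zsmul_eq_mul, Int.cast_natCast, mul_div_cancel₀ _ hN]

/-- The section returns to the same fiber, possibly at another point, so a function invariant under
`N`-torsion translations descends through it. -/
theorem exists_divSection_zsmul (t : UnitAddCircle) :
    ∃ l : ZMod N, divSection N ((N : ℤ) • t) = t + ZMod.toAddCircle l := by
  obtain ⟨l, hl⟩ := exists_eq_toAddCircle (N := N) (x := divSection N ((N : ℤ) • t) - t) (by
    rw [zsmul_sub, zsmul_divSection, sub_self])
  exact ⟨l, by rw [← hl, add_sub_cancel]⟩

/-- The `j`-th modulated average of `h` over the fibers of multiplication by `N`. -/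
noncomputable def fiberSum (N : ℕ) [NeZero N] (h : UnitAddCircle → ℂ) (j : ℕ)
    (t : UnitAddCircle) : ℂ :=
  ∑ l : ZMod N, fourier (-(j : ℤ)) (t + ZMod.toAddCircle l) * h (t + ZMod.toAddCircle l)

theorem fiberSum_add (h : UnitAddCircle → ℂ) (j : ℕ) (t : UnitAddCircle) (k : ZMod N) :
    fiberSum N h j (t + ZMod.toAddCircle k) = fiberSum N h j t := by
  unfold fiberSum
  rw [← Equiv.sum_comp (Equiv.addLeft k) (fun l : ZMod N =>
    fourier (-(j : ℤ)) (t + ZMod.toAddCircle l) * h (t + ZMod.toAddCircle l))]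
  refine Finset.sum_congr rfl fun l _ => ?_
  have hkl : t + ZMod.toAddCircle k + ZMod.toAddCircle l = t + ZMod.toAddCircle (k + l) := by
    rw [AddMonoidHom.map_add, add_assoc]
  rw [hkl, Equiv.coe_addLeft]

theorem fiberSum_divSection (h : UnitAddCircle → ℂ) (j : ℕ) (t : UnitAddCircle) :
    fiberSum N h j (divSection N ((N : ℤ) • t)) = fiberSum N h j t := by
  obtain ⟨l, hl⟩ := exists_divSection_zsmul (N := N) t
  rw [hl, fiberSum_add]

theorem measurable_fiberSum {h : UnitAddCircle → ℂ} (hm : Measurable h) (j : ℕ) :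
    Measurable (fiberSum N h j) :=
  Finset.measurable_fun_sum _ fun _ _ =>
    ((measurable_fourier _).mul hm).comp (measurable_add_const _)

theorem memLp_fiberSum {h : UnitAddCircle → ℂ} (hm : Measurable h) (hh : MemLp h 2 volume)
    (j : ℕ) : MemLp (fiberSum N h j) 2 volume :=
  memLp_finsetSum _ fun _ _ => (memLp_fourier_mul (-(j : ℤ)) hm hh).comp_measurePreserving
    (measurePreserving_add_right volume (ZMod.toAddCircle _))

/-- The character `fourier (-m) (N • t)` is constant on fibers, so it can be moved inside the fiber
sum, where it combines with `fourier (-j)`; each of the `N` translates then has the same integral.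
Orthogonality of `h` to frequency `N * m + j` thus becomes orthogonality of the folded function to
frequency `m`. -/
theorem integral_fourier_mul_fiberSum {h : UnitAddCircle → ℂ} (hm : Measurable h)
    (hh : MemLp h 2 volume) (j : ℕ) (m : ℤ) :
    ∫ u, fourier (-m) u * fiberSum N h j (divSection N u) =
      N * ∫ t, fourier (-(N * m + (j : ℤ))) t * h t := by
  have hmeas : Measurable fun u => fourier (-m) u * fiberSum N h j (divSection N u) :=
    (measurable_fourier _).mul ((measurable_fiberSum hm j).comp (measurable_divSection N))
  rw [← integral_comp_zsmul (N := N) hmeas.aestronglyMeasurable]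
  have h1 : ∀ t, fourier (-m) ((N : ℤ) • t) * fiberSum N h j (divSection N ((N : ℤ) • t)) =
      ∑ l : ZMod N, fourier (-(N * m + (j : ℤ))) (t + ZMod.toAddCircle l) *
        h (t + ZMod.toAddCircle l) := by
    intro t
    rw [fiberSum_divSection, fiberSum, Finset.mul_sum]
    refine Finset.sum_congr rfl fun l _ => ?_
    rw [neg_add, ← mul_neg, fourier_add, fourier_mul_zsmul, zsmul_add, zsmul_toAddCircle,
      add_zero, mul_assoc]
  simp_rw [h1]
  have hint := integrable_fourier_mul (-(N * m + (j : ℤ))) hm hh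
  rw [integral_finsetSum _ fun l _ => hint.comp_add_right (ZMod.toAddCircle l)]
  simp only [integral_add_right_eq_self (fun t => fourier (-(N * m + (j : ℤ))) t * h t)]
  simp [ZMod.card]

/-- The fiber sums are shown to vanish one index after another. Once those below `j` vanish, `h` is
zero on every fiber with at most `j` points in `S`; the `j`-th fiber sum is then supported in `B j`,
where completeness of `Λ j` kills it. -/
theorem isCompleteOn_combine {S : Set UnitAddCircle}
    {B : Fin N → Set UnitAddCircle} (hBm : ∀ j, MeasurableSet (B j))
    (hB : ∀ (j : Fin N) t, (N : ℤ) • t ∈ B j ↔ (j : ℕ) < (fiberIndices N S t).card)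
    {Λ : Fin N → Set ℤ} (hΛ : ∀ j, IsCompleteOn (B j) (Λ j)) :
    IsCompleteOn S {n | ∃ j : Fin N, ∃ m ∈ Λ j, n = N * m + (j : ℕ)} := by
  intro h hm hh hoff horth
  have hoff' : ∀ᵐ t, ∀ l : ZMod N, t + ZMod.toAddCircle l ∉ S → h (t + ZMod.toAddCircle l) = 0 :=
    ae_all_iff.mpr fun l =>
      ae_comp_add_right (p := fun t => t ∉ S → h t = 0) (ZMod.toAddCircle l) hoff
  -- On such a fiber the first `card` modulated sums form an invertible transposed Vandermonde
  -- system for the values of `h`.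
  have hvanish : ∀ k ≤ N, (∀ j < k, ∀ᵐ t, fiberSum N h j t = 0) →
      ∀ᵐ t, (fiberIndices N S t).card ≤ k → ∀ l : ZMod N, h (t + ZMod.toAddCircle l) = 0 := by
    intro k _ hk
    have hk' : ∀ᵐ t, ∀ j : Fin k, fiberSum N h j t = 0 := ae_all_iff.mpr fun j => hk j j.2
    filter_upwards [hoff', hk'] with t h1 h2 hcard
    have h3 := eq_zero_of_vandermonde_transpose
      (ζ := fun l : ZMod N => (fourier (-1) (ZMod.toAddCircle l) : ℂ))
      ((fourier_injective (Or.inr rfl)).comp (ZMod.toAddCircle_injective N))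
      (fiberIndices N S t) (fun l => h (t + ZMod.toAddCircle l)) fun j hj => by
        have h4 := h2 ⟨j, hj.trans_le hcard⟩
        have h5 : fiberSum N h j t = fourier (-(j : ℤ)) t * ∑ l ∈ fiberIndices N S t,
            h (t + ZMod.toAddCircle l) * fourier (-1) (ZMod.toAddCircle l) ^ j := by
          rw [fiberSum, Finset.mul_sum]
          symm
          refine Finset.sum_subset_zero_on_sdiff (Finset.subset_univ _) ?_ ?_
          · intro l hl
            rw [h1 l fun hmem => (Finset.mem_sdiff.mp hl).2 (mem_fiberIndices.mpr hmem), mul_zero]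
          · intro l _
            rw [fourier_add_arg, ← fourier_mul_natCast, neg_one_mul]
            ring
        rw [h5] at h4
        refine (mul_eq_zero.mp h4).resolve_left fun h6 => ?_
        have := norm_fourier_apply (-(j : ℤ)) t
        rw [h6, norm_zero] at this
        exact zero_ne_one this
    intro l
    by_cases hl : t + ZMod.toAddCircle l ∈ S
    · exact h3 l (mem_fiberIndices.mpr hl)
    · exact h1 l hl
  have hall : ∀ k ≤ N, ∀ j < k, ∀ᵐ t, fiberSum N h j t = 0 := by
    intro k
    induction k with
    | zero => intro _ j hj; omega
    | succ k ih =>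
      intro hkN j hj
      rcases (Nat.lt_succ_iff_lt_or_eq.mp hj) with hj | rfl
      · exact ih (by omega) j hj
      have h1 := hvanish j (by omega) (ih (by omega))
      let H : UnitAddCircle → ℂ := fun u => fiberSum N h j (divSection N u)
      have hHm : Measurable H := (measurable_fiberSum hm j).comp (measurable_divSection N)
      have hmp := measurePreserving_zsmul_natCast (N := N)
      have hHN : H ∘ (fun t => (N : ℤ) • t) = fiberSum N h j :=
        funext fun t => fiberSum_divSection h j t
      have hHL : MemLp H 2 volume := by
        rw [← hmp.map_eq, memLp_map_measure_iff hHm.aestronglyMeasurable hmp.measurable.aemeasurable,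
          hHN]
        exact memLp_fiberSum hm hh j
      -- Off `B j` the fiber has at most `j` points in `S`, so all values of `h` entering the fiber
      -- sum are already zero.
      have hHoff : ∀ᵐ u, u ∉ B ⟨j, hkN⟩ → H u = 0 := by
        rw [← hmp.map_eq, ae_map_iff hmp.measurable.aemeasurable]
        · filter_upwards [h1] with t ht hu
          rw [hB, not_lt] at hu
          have h2 := ht hu
          change H ((N : ℤ) • t) = 0
          simp only [H]
          rw [fiberSum_divSection, fiberSum]
          exact Finset.sum_eq_zero fun l _ => by rw [h2 l, mul_zero]
        · have : {u | u ∉ B ⟨j, hkN⟩ → H u = 0} = B ⟨j, hkN⟩ ∪ H ⁻¹' {0} := by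
            ext u
            simp [or_iff_not_imp_left]
          rw [this]
          exact (hBm _).union (hHm (measurableSet_singleton 0))
      have hH0 := hΛ ⟨j, hkN⟩ H hHm hHL hHoff fun m hmΛ => by
        simp only [H]
        rw [integral_fourier_mul_fiberSum hm hh, horth _ ⟨⟨j, hkN⟩, m, hmΛ, rfl⟩, mul_zero]
      filter_upwards [ae_comp_zsmul (p := fun u => H u = 0) N hH0] with t ht
      rw [← fiberSum_divSection]
      exact ht
  -- A fiber has only `N` points in total, so the cardinality condition is now automatic.
  filter_upwards [hvanish N le_rfl (hall N le_rfl)] with t ht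
  have := ht ((Finset.card_le_univ _).trans_eq (ZMod.card N)) 0
  simpa using this

end Combination

/-! ### The extreme cases: the whole circle and null sets -/

theorem hasRieszLowerBound_univ : HasRieszLowerBound univ univ :=
  ⟨1, one_pos, fun s a _ => by
    rw [one_mul, Measure.restrict_univ, integral_norm_sq_sum_fourier]⟩

theorem isCompleteOn_univ : IsCompleteOn univ univ := by
  intro h _ hh _ horth
  rw [UnitAddCircle.volume_eq_haarAddCircle] at hh horth ⊢
  have h0 : hh.toLp = 0 := by
    refine fourierBasis.repr.injective ?_
    ext n
    rw [fourierBasis_repr, fourierCoeff_congr_ae hh.coeFn_toLp, fourierCoeff]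
    simpa using horth n (mem_univ n)
  exact hh.coeFn_toLp.symm.trans ((Lp.eq_zero_iff_ae_eq_zero).mp h0)

theorem hasRieszLowerBound_empty (B : Set UnitAddCircle) : HasRieszLowerBound B ∅ :=
  ⟨1, one_pos, fun s a hs => by
    obtain rfl : s = ∅ := Finset.eq_empty_of_forall_notMem hs
    simp⟩

theorem isCompleteOn_of_measure_zero {B : Set UnitAddCircle} (hB : volume B = 0) :
    IsCompleteOn B ∅ := by
  intro h _ _ hoff _
  have : ∀ᵐ t, t ∉ B := measure_eq_zero_iff_ae_notMem.mp hB
  filter_upwards [hoff, this] with t h1 h2 using h1 h2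

/-! ### Paley–Wiener perturbation on a short interval -/

/-- Cauchy–Schwarz on an interval. -/
theorem sq_intervalIntegral_le {ℓ : ℝ} (hℓ : 0 < ℓ) {f : ℝ → ℝ} (hf : Continuous f) :
    (∫ y in 0..ℓ, f y) ^ 2 ≤ ℓ * ∫ y in 0..ℓ, f y ^ 2 := by
  set m := (∫ y in 0..ℓ, f y) / ℓ with hm
  have h1 : 0 ≤ ∫ y in 0..ℓ, (f y - m) ^ 2 :=
    intervalIntegral.integral_nonneg hℓ.le fun y _ => sq_nonneg _
  have h2 : ∫ y in 0..ℓ, (f y - m) ^ 2 =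
      (∫ y in 0..ℓ, f y ^ 2) - 2 * m * (∫ y in 0..ℓ, f y) + ℓ * m ^ 2 := by
    have : ∀ y, (f y - m) ^ 2 = f y ^ 2 - 2 * m * f y + m ^ 2 := fun y => by ring
    simp_rw [this]
    rw [intervalIntegral.integral_add, intervalIntegral.integral_sub,
      intervalIntegral.integral_const_mul, intervalIntegral.integral_const]
    · simp
    all_goals exact Continuous.intervalIntegrable (by fun_prop) _ _
  have h3 : ∫ y in 0..ℓ, f y = ℓ * m := by rw [hm]; field_simp
  rw [h2, h3] at h1
  rw [h3]
  nlinarith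

theorem norm_exp_ofReal_mul_I_mul (δ y : ℝ) : ‖Complex.exp (Complex.I * δ * y)‖ = 1 := by
  rw [Complex.norm_exp]
  simp

/-- The Paley–Wiener perturbation estimate. -/
theorem integral_norm_sq_perturbation_le {ℓ : ℝ} [hℓ : Fact (0 < ℓ)] (α : ℝ) {δ : ℤ → ℝ} {M : ℝ}
    (hδ : ∀ n, |δ n| ≤ M) (s : Finset ℤ) (c : ℤ → ℂ) :
    ∫ x in α..α + ℓ, ‖∑ n ∈ s, c n * fourier n (x : AddCircle ℓ) *
      (Complex.exp (Complex.I * δ n * (x - α : ℝ)) - 1)‖ ^ 2 ≤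
        (M * ℓ) ^ 2 * (ℓ * ∑ n ∈ s, ‖c n‖ ^ 2) := by
  -- The factor `exp (I * δ n * (x - α)) - 1` is an integral over `y` from `0` to `x - α`; `P x y`
  -- is the resulting integrand, with `y` decoupled from `x`.
  obtain ⟨P, hP⟩ : ∃ P : ℝ → ℝ → ℂ, ∀ x y, P x y = ∑ n ∈ s, (c n * (Complex.I * δ n) *
      Complex.exp (Complex.I * δ n * y)) * fourier n (x : AddCircle ℓ) := ⟨_, fun _ _ => rfl⟩
  have hPc : Continuous (Function.uncurry P) := by
    have : Function.uncurry P = fun p : ℝ × ℝ => ∑ n ∈ s, (c n * (Complex.I * δ n) *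
        Complex.exp (Complex.I * δ n * p.2)) * fourier n (p.1 : AddCircle ℓ) :=
      funext fun p => hP p.1 p.2
    rw [this]
    refine continuous_finsetSum _ fun n _ => ?_
    refine Continuous.mul (by fun_prop) ?_
    exact (fourier n).continuous.comp ((AddCircle.continuous_mk' ℓ).comp continuous_fst)
  have hPy : ∀ x, Continuous (P x) := fun x =>
    hPc.comp (Continuous.prodMk_right x)
  have hFTC : ∀ x : ℝ, ∑ n ∈ s, c n * fourier n (x : AddCircle ℓ) *
      (Complex.exp (Complex.I * δ n * (x - α : ℝ)) - 1) = ∫ y in 0..x - α, P x y := by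
    intro x
    have hd : ∀ y : ℝ, HasDerivAt (fun y : ℝ => ∑ n ∈ s, c n * fourier n (x : AddCircle ℓ) *
        Complex.exp (Complex.I * δ n * y)) (P x y) y := by
      intro y
      rw [hP]
      refine HasDerivAt.fun_sum fun n _ => ?_
      have h1 : HasDerivAt (fun y : ℝ => Complex.I * δ n * (y : ℂ)) (Complex.I * δ n * 1) y :=
        (Complex.ofRealCLM.hasDerivAt (x := y)).const_mul (Complex.I * δ n)
      have h2 := h1.cexp.const_mul (c n * fourier n (x : AddCircle ℓ))
      refine h2.congr_deriv ?_
      rw [mul_one]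
      ring
    rw [intervalIntegral.integral_eq_sub_of_hasDerivAt (fun y _ => hd y)
      ((hPy x).intervalIntegrable _ _), ← Finset.sum_sub_distrib]
    refine Finset.sum_congr rfl fun n _ => ?_
    simp only [Complex.ofReal_zero, mul_zero, Complex.exp_zero]
    ring
  -- Cauchy–Schwarz, with the range enlarged to `[0, ℓ]` so that it no longer depends on `x` and the
  -- integrals can be swapped.
  have hbound : ∀ x ∈ Icc α (α + ℓ), ‖∫ y in 0..x - α, P x y‖ ^ 2 ≤
      ℓ * ∫ y in 0..ℓ, ‖P x y‖ ^ 2 := by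
    intro x hx
    refine le_trans ?_ (sq_intervalIntegral_le hℓ.out (hPy x).norm)
    refine pow_le_pow_left₀ (norm_nonneg _) ?_ 2
    refine (intervalIntegral.norm_integral_le_integral_norm (by linarith [hx.1])).trans ?_
    exact intervalIntegral.integral_mono_interval le_rfl (by linarith [hx.1]) (by linarith [hx.2])
      (Filter.Eventually.of_forall fun y => norm_nonneg _) ((hPy x).norm.intervalIntegrable _ _)
  -- For fixed `y`, `P` is a trigonometric polynomial in `x` with coefficients of modulus at most `M
  -- * ‖c n‖`, so Parseval applies.
  have hinner : ∀ y, ∫ x in α..α + ℓ, ‖P x y‖ ^ 2 ≤ M ^ 2 * (ℓ * ∑ n ∈ s, ‖c n‖ ^ 2) := by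
    intro y
    simp_rw [hP]
    rw [intervalIntegral_norm_sq_sum_fourier, mul_left_comm]
    refine mul_le_mul_of_nonneg_left ?_ hℓ.out.le
    rw [Finset.mul_sum]
    refine Finset.sum_le_sum fun n _ => ?_
    rw [norm_mul, norm_mul, norm_exp_ofReal_mul_I_mul, norm_mul, Complex.norm_I, one_mul, mul_one,
      Complex.norm_real, mul_pow, mul_comm]
    refine mul_le_mul_of_nonneg_right ?_ (by positivity)
    exact pow_le_pow_left₀ (norm_nonneg _) (hδ n) 2
  have hPsq : Continuous (Function.uncurry fun x y => ‖P x y‖ ^ 2) := by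
    have := hPc.norm.pow 2
    exact this
  simp_rw [hFTC]
  have hle : α ≤ α + ℓ := by linarith [hℓ.out]
  calc ∫ x in α..α + ℓ, ‖∫ y in 0..x - α, P x y‖ ^ 2
      ≤ ∫ x in α..α + ℓ, ℓ * ∫ y in 0..ℓ, ‖P x y‖ ^ 2 := by
        refine intervalIntegral.integral_mono_on hle ?_ ?_ hbound
        · simp_rw [← hFTC]
          refine Continuous.intervalIntegrable ?_ _ _
          refine (continuous_finsetSum _ fun n _ => ?_).norm.pow 2
          refine Continuous.mul (continuous_const.mul ?_) (by fun_prop)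
          exact (fourier n).continuous.comp (AddCircle.continuous_mk' ℓ)
        · refine Continuous.intervalIntegrable ?_ _ _
          exact continuous_const.mul
            (intervalIntegral.continuous_parametric_intervalIntegral_of_continuous' hPsq 0 ℓ)
    _ = ℓ * ∫ y in 0..ℓ, ∫ x in α..α + ℓ, ‖P x y‖ ^ 2 := by
        rw [intervalIntegral.integral_const_mul, intervalIntegral_intervalIntegral_swap]
        refine (hPsq.continuousOn.integrableOn_compact
          (isCompact_uIcc.prod isCompact_uIcc)).mono_set (prod_mono uIoc_subset_uIcc uIoc_subset_uIcc)
    _ ≤ ℓ * ∫ y in 0..ℓ, M ^ 2 * (ℓ * ∑ n ∈ s, ‖c n‖ ^ 2) := by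
        refine mul_le_mul_of_nonneg_left ?_ hℓ.out.le
        refine intervalIntegral.integral_mono_on hℓ.out.le ?_ (by simp) fun y _ => hinner y
        refine Continuous.intervalIntegrable ?_ _ _
        have : Continuous (Function.uncurry fun y x => ‖P x y‖ ^ 2) := hPsq.comp continuous_swap
        exact intervalIntegral.continuous_parametric_intervalIntegral_of_continuous' this _ _
    _ = (M * ℓ) ^ 2 * (ℓ * ∑ n ∈ s, ‖c n‖ ^ 2) := by
        rw [intervalIntegral.integral_const, sub_zero, smul_eq_mul]
        ring

/-- The integer closest to `n / ℓ`. -/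
noncomputable def roundFreq (ℓ : ℝ) (n : ℤ) : ℤ := round (n / ℓ)

/-- The deviation, as an angular frequency, of `roundFreq ℓ n` from `n / ℓ`. -/
noncomputable def roundPhase (ℓ : ℝ) (n : ℤ) : ℝ := 2 * Real.pi * (roundFreq ℓ n - n / ℓ)

theorem abs_roundPhase_le (ℓ : ℝ) (n : ℤ) : |roundPhase ℓ n| ≤ Real.pi := by
  have h := abs_sub_round ((n : ℝ) / ℓ)
  rw [abs_sub_comm] at h
  rw [roundPhase, roundFreq, abs_mul, abs_of_pos (by positivity)]
  nlinarith [Real.pi_pos]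

/-- The points `n / ℓ` are more than 1 apart, while two reals with the same rounding differ by at
most 1. -/
theorem roundFreq_injective {ℓ : ℝ} (hℓ : 0 < ℓ) (hℓ1 : ℓ < 1) :
    Function.Injective (roundFreq ℓ) := by
  intro m n h
  by_contra hmn
  have h1 := abs_le.mp (abs_sub_round ((m : ℝ) / ℓ))
  have h2 := abs_le.mp (abs_sub_round ((n : ℝ) / ℓ))
  have h3 : (round ((m : ℝ) / ℓ) : ℝ) = round ((n : ℝ) / ℓ) := by exact_mod_cast h
  have h4 : |(m : ℝ) / ℓ - n / ℓ| ≤ 1 := by rw [abs_le]; constructor <;> linarith [h1.1, h1.2, h2.1, h2.2]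
  rw [← sub_div, abs_div, abs_of_pos hℓ, div_le_one hℓ] at h4
  have h5 : (1 : ℝ) ≤ |(m : ℝ) - n| := by
    exact_mod_cast Int.one_le_abs (sub_ne_zero.mpr hmn)
  linarith

/-- The perturbation is normalized to equal 1 at `x = α`, at the price of a unimodular constant that
affects neither norms nor orthogonality. -/
theorem fourier_roundFreq {ℓ : ℝ} (hℓ : 0 < ℓ) (α : ℝ) (n : ℤ) (x : ℝ) :
    (fourier (roundFreq ℓ n) (x : UnitAddCircle) : ℂ) =
      Complex.exp (Complex.I * roundPhase ℓ n * α) * (fourier n (x : AddCircle ℓ) *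
        Complex.exp (Complex.I * roundPhase ℓ n * (x - α : ℝ))) := by
  rw [fourier_coe_apply, fourier_coe_apply, ← Complex.exp_add, ← Complex.exp_add, roundPhase]
  congr 1
  have : (ℓ : ℂ) ≠ 0 := by exact_mod_cast hℓ.ne'
  push_cast
  field_simp
  ring

section Arc

variable {ℓ : ℝ} [hℓ : Fact (0 < ℓ)]

/-- With `A` the perturbed sum and `G` the error, `‖A‖² ≥ ‖A - G‖² / 2 - ‖G‖²`. The unperturbed sum
has energy `ℓ ∑ ‖c n‖²` and the error at most a quarter of it, which leaves `ℓ / 4`. -/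
theorem le_integral_norm_sq_sum_perturbed (hℓ1 : ℓ ≤ 1 / 10) (α : ℝ) (s : Finset ℤ) (c : ℤ → ℂ) :
    ℓ / 4 * ∑ n ∈ s, ‖c n‖ ^ 2 ≤ ∫ x in α..α + ℓ, ‖∑ n ∈ s, c n * (fourier n (x : AddCircle ℓ) *
        Complex.exp (Complex.I * roundPhase ℓ n * (x - α : ℝ)))‖ ^ 2 := by
  have h1 := intervalIntegral_norm_sq_sum_fourier (T := ℓ) α s c
  have h2 := integral_norm_sq_perturbation_le (ℓ := ℓ) α (abs_roundPhase_le ℓ) s c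
  have hθ : (Real.pi * ℓ) ^ 2 ≤ 1 / 4 := by
    have : Real.pi * ℓ ≤ 1 / 2 := by nlinarith [Real.pi_lt_four, Real.pi_pos, hℓ.out]
    nlinarith [mul_pos Real.pi_pos hℓ.out]
  have hσ : 0 ≤ ℓ * ∑ n ∈ s, ‖c n‖ ^ 2 :=
    mul_nonneg hℓ.out.le (Finset.sum_nonneg fun n _ => by positivity)
  have hle : α ≤ α + ℓ := by linarith [hℓ.out]
  have h3 : ∫ x in α..α + ℓ, (1 / 2 * ‖∑ n ∈ s, c n * fourier n (x : AddCircle ℓ)‖ ^ 2 -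
      ‖∑ n ∈ s, c n * fourier n (x : AddCircle ℓ) *
        (Complex.exp (Complex.I * roundPhase ℓ n * (x - α : ℝ)) - 1)‖ ^ 2) ≤
      ∫ x in α..α + ℓ, ‖∑ n ∈ s, c n * (fourier n (x : AddCircle ℓ) *
        Complex.exp (Complex.I * roundPhase ℓ n * (x - α : ℝ)))‖ ^ 2 := by
    refine intervalIntegral.integral_mono_on hle ?_ ?_ fun x _ => ?_
    · exact Continuous.intervalIntegrable (by fun_prop) _ _
    · exact Continuous.intervalIntegrable (by fun_prop) _ _
    · set A := ∑ n ∈ s, c n * (fourier n (x : AddCircle ℓ) *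
        Complex.exp (Complex.I * roundPhase ℓ n * (x - α : ℝ)))
      set G := ∑ n ∈ s, c n * fourier n (x : AddCircle ℓ) *
        (Complex.exp (Complex.I * roundPhase ℓ n * (x - α : ℝ)) - 1)
      have hAG : ∑ n ∈ s, c n * fourier n (x : AddCircle ℓ) = A - G := by
        rw [← Finset.sum_sub_distrib]
        exact Finset.sum_congr rfl fun n _ => by ring
      rw [hAG]
      nlinarith [norm_sub_le A G, norm_nonneg (A - G), norm_nonneg A, norm_nonneg G,
        sq_nonneg (‖A‖ - ‖G‖)]
  rw [intervalIntegral.integral_sub, intervalIntegral.integral_const_mul, h1] at h3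
  · nlinarith
  all_goals exact Continuous.intervalIntegrable (by fun_prop) _ _

/-- If `g ∈ L²(α, α + ℓ)` is orthogonal to all the perturbed exponentials, then it vanishes. -/
theorem ae_eq_zero_of_orthogonal_perturbed (hℓ1 : ℓ ≤ 1 / 10) (α : ℝ) {g : ℝ → ℂ}
    (hg : MemLp g 2 (volume.restrict (Ioc α (α + ℓ))))
    (horth : ∀ n : ℤ, ∫ x in α..α + ℓ, starRingEnd ℂ (fourier n (x : AddCircle ℓ) *
      Complex.exp (Complex.I * roundPhase ℓ n * (x - α : ℝ))) * g x = 0) :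
    g =ᵐ[volume.restrict (Ioc α (α + ℓ))] 0 := by
  have hlt : α < α + ℓ := by linarith [hℓ.out]
  have hEc : ∀ n, Continuous fun x : ℝ => (fourier n (x : AddCircle ℓ) : ℂ) := fun n =>
    (fourier n).continuous.comp (AddCircle.continuous_mk' ℓ)
  have hg1 : IntervalIntegrable g volume α (α + ℓ) := by
    rw [intervalIntegrable_iff_integrableOn_Ioc_of_le hlt.le]
    exact hg.integrable (by norm_num)
  have hg2 : IntervalIntegrable (fun x => ‖g x‖ ^ 2) volume α (α + ℓ) := by
    rw [intervalIntegrable_iff_integrableOn_Ioc_of_le hlt.le]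
    exact hg.integrable_norm_pow two_ne_zero
  have hpars := hasSum_sq_fourierCoeffOn hlt hg
  have hcoeff : ∀ n, ∫ x in α..α + ℓ, starRingEnd ℂ (fourier n (x : AddCircle ℓ)) * g x =
      ℓ * fourierCoeffOn hlt g n := by
    intro n
    rw [fourierCoeffOn_eq_integral]
    have h0 : (ℓ : ℂ) ≠ 0 := by exact_mod_cast hℓ.out.ne'
    have h1 : α + ℓ - α = ℓ := add_sub_cancel_left α ℓ
    have h2 : ∀ x : ℝ, (fourier (-n) (x : AddCircle (α + ℓ - α)) : ℂ) =
        starRingEnd ℂ (fourier n (x : AddCircle ℓ)) := fun x => by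
      rw [← fourier_neg, fourier_coe_apply, fourier_coe_apply, h1]
    simp_rw [h2, h1, smul_eq_mul, Complex.real_smul]
    push_cast
    field_simp
  generalize hγ : fourierCoeffOn hlt g = γ at hpars hcoeff
  have hI : ∫ x in α..α + ℓ, ‖g x‖ ^ 2 ≤ 0 := by
    -- Pairing `g` with the error `D` of its own partial Fourier sum gives `-ℓ * σ`, because the
    -- perturbed part is orthogonal to `g`. Then `ℓ * σ ≤ ∫ ‖g‖² / 4 + ∫ ‖D‖²` and `∫ ‖D‖² ≤ ℓ * σ /
    -- 4`, so `ℓ * σ` is at most half of `∫ ‖g‖²`.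
    have hbound : ∀ s : Finset ℤ, ∑ n ∈ s, ‖γ n‖ ^ 2 ≤ 1 / 2 * (ℓ⁻¹ * ∫ x in α..α + ℓ, ‖g x‖ ^ 2) := by
      intro s
      have hPW := integral_norm_sq_perturbation_le (ℓ := ℓ) α (abs_roundPhase_le ℓ) s γ
      obtain ⟨D, hD⟩ : ∃ D : ℝ → ℂ, ∀ x, D x = ∑ n ∈ s, γ n * fourier n (x : AddCircle ℓ) *
        (Complex.exp (Complex.I * roundPhase ℓ n * (x - α : ℝ)) - 1) := ⟨_, fun _ => rfl⟩
      have hDc : Continuous D := by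
        rw [funext hD]
        fun_prop
      simp_rw [← hD] at hPW
      have hθ : (Real.pi * ℓ) ^ 2 ≤ 1 / 4 := by
        have : Real.pi * ℓ ≤ 1 / 2 := by nlinarith [Real.pi_lt_four, Real.pi_pos, hℓ.out]
        nlinarith [mul_pos Real.pi_pos hℓ.out]
      set σ := ∑ n ∈ s, ‖γ n‖ ^ 2 with hσdef
      have hσ : 0 ≤ σ := Finset.sum_nonneg fun n _ => by positivity
      have hkey : ∫ x in α..α + ℓ, starRingEnd ℂ (D x) * g x = -((ℓ * σ : ℝ) : ℂ) := by
        have h1 : ∀ x, starRingEnd ℂ (D x) * g x = ∑ n ∈ s, starRingEnd ℂ (γ n) *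
            (starRingEnd ℂ (fourier n (x : AddCircle ℓ) *
              Complex.exp (Complex.I * roundPhase ℓ n * (x - α : ℝ))) * g x -
              starRingEnd ℂ (fourier n (x : AddCircle ℓ)) * g x) := by
          intro x
          rw [hD, map_sum, Finset.sum_mul]
          refine Finset.sum_congr rfl fun n _ => ?_
          simp only [map_mul, map_sub, map_one]
          ring
        have hint1 : ∀ n, IntervalIntegrable (fun x => starRingEnd ℂ (fourier n (x : AddCircle ℓ) *
              Complex.exp (Complex.I * roundPhase ℓ n * (x - α : ℝ))) * g x) volume α (α + ℓ) :=
          fun n => hg1.continuousOn_mul (by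
            refine Continuous.continuousOn ?_
            exact Complex.continuous_conj.comp ((hEc n).mul (by fun_prop)))
        have hint2 : ∀ n, IntervalIntegrable
            (fun x => starRingEnd ℂ (fourier n (x : AddCircle ℓ)) * g x) volume α (α + ℓ) :=
          fun n => hg1.continuousOn_mul (Complex.continuous_conj.comp (hEc n)).continuousOn
        simp_rw [h1]
        rw [intervalIntegral.integral_finsetSum fun n _ => ((hint1 n).sub (hint2 n)).const_mul _]
        have h2 : ∀ n ∈ s, ∫ x in α..α + ℓ, starRingEnd ℂ (γ n) *
            (starRingEnd ℂ (fourier n (x : AddCircle ℓ) *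
              Complex.exp (Complex.I * roundPhase ℓ n * (x - α : ℝ))) * g x -
              starRingEnd ℂ (fourier n (x : AddCircle ℓ)) * g x) = -((ℓ * ‖γ n‖ ^ 2 : ℝ) : ℂ) := by
          intro n _
          rw [intervalIntegral.integral_const_mul,
            intervalIntegral.integral_sub (hint1 n) (hint2 n), horth, hcoeff, zero_sub, mul_neg,
            mul_left_comm, RCLike.conj_mul]
          push_cast
          rfl
        rw [Finset.sum_congr rfl h2, Finset.sum_neg_distrib, hσdef, Finset.mul_sum]
        push_cast
        rfl
      have hDint : IntervalIntegrable (fun x => ‖D x‖ ^ 2) volume α (α + ℓ) :=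
        (hDc.norm.pow 2).intervalIntegrable _ _
      have hle : ‖∫ x in α..α + ℓ, starRingEnd ℂ (D x) * g x‖ ≤
          ∫ x in α..α + ℓ, (1 / 4 * ‖g x‖ ^ 2 + ‖D x‖ ^ 2) := by
        refine intervalIntegral.norm_integral_le_of_norm_le hlt.le
          (Filter.Eventually.of_forall fun x _ => ?_) ((hg2.const_mul _).add hDint)
        rw [norm_mul, RCLike.norm_conj]
        nlinarith [sq_nonneg (‖g x‖ / 2 - ‖D x‖)]
      rw [hkey, norm_neg, Complex.norm_real, Real.norm_of_nonneg (mul_nonneg hℓ.out.le hσ),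
        intervalIntegral.integral_add (hg2.const_mul _) hDint,
        intervalIntegral.integral_const_mul] at hle
      have h4 : 0 ≤ ℓ * σ := mul_nonneg hℓ.out.le hσ
      have h5 : ℓ * σ ≤ 1 / 2 * ∫ x in α..α + ℓ, ‖g x‖ ^ 2 := by
        have h6 : 0 ≤ ∫ x in α..α + ℓ, ‖g x‖ ^ 2 :=
          intervalIntegral.integral_nonneg hlt.le fun x _ => by positivity
        nlinarith
      rw [mul_left_comm, ← div_eq_inv_mul, le_div_iff₀ hℓ.out, mul_comm]
      exact h5
    -- Parseval makes the limit of the left side the full `ℓ⁻¹ * ∫ ‖g‖²`, so the energy is at most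
    -- half of itself.
    have hlim := le_of_tendsto' hpars hbound
    rw [add_sub_cancel_left, smul_eq_mul] at hlim
    have : 0 < ℓ⁻¹ := inv_pos.mpr hℓ.out
    by_contra hneg
    rw [not_le] at hneg
    nlinarith [mul_pos this hneg]
  rw [intervalIntegral.integral_of_le hlt.le] at hI
  have h0 : ∫ x in Ioc α (α + ℓ), ‖g x‖ ^ 2 = 0 :=
    le_antisymm hI (integral_nonneg fun x => by positivity)
  rw [integral_eq_zero_iff_of_nonneg (fun x => by positivity)
    (hg.integrable_norm_pow two_ne_zero)] at h0
  filter_upwards [h0] with x hx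
  simpa using hx

end Arc

/-! ### Frequencies for short arcs -/

/-- A set on the circle whose lift to `(0, 1]` is, up to endpoints, a short interval. -/
structure IsShortArc (B : Set UnitAddCircle) (α ℓ : ℝ) : Prop where
  measurableSet : MeasurableSet B
  start_pos : 0 < α
  end_lt_one : α + ℓ < 1
  length_pos : 0 < ℓ
  length_le : ℓ ≤ 1 / 10
  mem_of_mem_Ioo : ∀ x ∈ Ioo α (α + ℓ), (x : UnitAddCircle) ∈ B
  mem_Icc_of_mem : ∀ x ∈ Ioc (0 : ℝ) 1, (x : UnitAddCircle) ∈ B → x ∈ Icc α (α + ℓ)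

namespace IsShortArc

variable {B : Set UnitAddCircle} {α ℓ : ℝ}

theorem setIntegral (hB : IsShortArc B α ℓ) {E : Type*} [NormedAddCommGroup E] [NormedSpace ℝ E]
    (F : UnitAddCircle → E) : ∫ t in B, F t = ∫ x in α..α + ℓ, F (x : UnitAddCircle) := by
  have hlt : α < α + ℓ := by linarith [hB.length_pos]
  let S : Set ℝ := Ioc 0 1 ∩ (fun x : ℝ => (x : UnitAddCircle)) ⁻¹' B
  have hmS : MeasurableSet S := measurableSet_Ioc.inter (AddCircle.measurable_mk' hB.measurableSet)
  have hSsub : S ⊆ Icc α (α + ℓ) := fun x hx => hB.mem_Icc_of_mem x hx.1 hx.2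
  have hS : S ⊆ Ioo 0 1 := fun x hx =>
    ⟨hB.start_pos.trans_le (hSsub hx).1, (hSsub hx).2.trans_lt hB.end_lt_one⟩
  have hsup : Ioo α (α + ℓ) ⊆ S := fun x hx =>
    ⟨⟨hB.start_pos.trans hx.1, (hx.2.trans hB.end_lt_one).le⟩, hB.mem_of_mem_Ioo x hx⟩
  have hae : S =ᵐ[volume] Ioc α (α + ℓ) := by
    refine Filter.EventuallyLE.antisymm ?_ ?_
    · exact hSsub.eventuallyLE.trans Ioc_ae_eq_Icc.symm.le
    · exact Ioo_ae_eq_Ioc.symm.le.trans hsup.eventuallyLE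
  rw [setIntegral_lift hS hmS hB.measurableSet (fun x hx => ⟨fun h => ⟨hx, h⟩, fun h => h.2⟩),
    setIntegral_congr_set hae, intervalIntegral.integral_of_le hlt.le]

theorem hasRieszLowerBound (hB : IsShortArc B α ℓ) :
    HasRieszLowerBound B (range (roundFreq ℓ)) := by
  classical
  have : Fact (0 < ℓ) := ⟨hB.length_pos⟩
  have hinj := roundFreq_injective hB.length_pos (by linarith [hB.length_le])
  refine ⟨ℓ / 4, by linarith [hB.length_pos], fun s a hs => ?_⟩
  obtain ⟨s', rfl⟩ : ∃ s' : Finset ℤ, s = s'.image (roundFreq ℓ) := by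
    refine ⟨s.preimage (roundFreq ℓ) hinj.injOn, ?_⟩
    rw [Finset.image_preimage, Finset.filter_true_of_mem hs]
  rw [Finset.sum_image hinj.injOn, hB.setIntegral]
  have h := le_integral_norm_sq_sum_perturbed (ℓ := ℓ) hB.length_le α s'
    fun n => a (roundFreq ℓ n) * Complex.exp (Complex.I * roundPhase ℓ n * α)
  simp only [norm_mul, norm_exp_ofReal_mul_I_mul, mul_one] at h
  refine h.trans_eq ?_
  congr 1
  funext x
  rw [Finset.sum_image hinj.injOn]
  congr 2
  refine Finset.sum_congr rfl fun n _ => ?_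
  rw [fourier_roundFreq hB.length_pos α, mul_assoc]

theorem isCompleteOn (hB : IsShortArc B α ℓ) : IsCompleteOn B (range (roundFreq ℓ)) := by
  have : Fact (0 < ℓ) := ⟨hB.length_pos⟩
  have hlt : α < α + ℓ := by linarith [hB.length_pos]
  intro h hm hh hoff horth
  have hmk := UnitAddCircle.measurePreserving_mk 0
  have hsub : Ioc α (α + ℓ) ⊆ Ioc 0 (0 + 1) := fun x hx =>
    ⟨hB.start_pos.trans hx.1, by linarith [hx.2, hB.end_lt_one]⟩
  have hg : MemLp (fun x : ℝ => h x) 2 (volume.restrict (Ioc α (α + ℓ))) :=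
    (hh.comp_measurePreserving hmk).mono_measure (Measure.restrict_mono_set _ hsub)
  have hg0 := ae_eq_zero_of_orthogonal_perturbed (ℓ := ℓ) hB.length_le α hg fun n => by
    have h1 := horth _ ⟨n, rfl⟩
    have h2 : ∫ t, fourier (-roundFreq ℓ n) t * h t =
        ∫ t in B, fourier (-roundFreq ℓ n) t * h t := by
      rw [← integral_indicator hB.measurableSet]
      refine integral_congr_ae ?_
      filter_upwards [hoff] with t ht
      by_cases htB : t ∈ B
      · rw [indicator_of_mem htB]
      · rw [indicator_of_notMem htB, ht htB, mul_zero]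
    rw [h2, hB.setIntegral] at h1
    have h3 : ∀ x : ℝ, fourier (-roundFreq ℓ n) (x : UnitAddCircle) * h x =
        starRingEnd ℂ (Complex.exp (Complex.I * roundPhase ℓ n * α)) *
          (starRingEnd ℂ (fourier n (x : AddCircle ℓ) *
            Complex.exp (Complex.I * roundPhase ℓ n * (x - α : ℝ))) * h x) := fun x => by
      rw [fourier_neg, fourier_roundFreq hB.length_pos α, map_mul (starRingEnd ℂ)
        (Complex.exp (Complex.I * roundPhase ℓ n * α)), mul_assoc]
    simp_rw [h3] at h1
    rw [intervalIntegral.integral_const_mul] at h1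
    refine (mul_eq_zero.mp h1).resolve_left fun h5 => ?_
    have h4 := norm_exp_ofReal_mul_I_mul (roundPhase ℓ n) α
    rw [← RCLike.norm_conj, h5, norm_zero] at h4
    exact zero_ne_one h4
  have hoff' : ∀ᵐ x : ℝ ∂volume.restrict (Ioc 0 (0 + 1)),
      (x : UnitAddCircle) ∉ B → h (x : UnitAddCircle) = 0 :=
    hmk.quasiMeasurePreserving.ae hoff
  have hms : MeasurableSet {t | h t = 0} := hm (measurableSet_singleton 0)
  change ∀ᵐ t, h t = 0
  rw [← hmk.map_eq, ae_map_iff hmk.measurable.aemeasurable hms]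
  have hg0' : ∀ᵐ x : ℝ, x ∈ Ioc α (α + ℓ) → h (x : UnitAddCircle) = 0 :=
    (ae_restrict_iff' measurableSet_Ioc).mp hg0
  have hα : ∀ᵐ x : ℝ, x ≠ α := by simp [ae_iff]
  filter_upwards [hoff', ae_restrict_of_ae hg0', ae_restrict_of_ae hα,
    ae_restrict_mem measurableSet_Ioc] with x h1 h2 h3 h4
  by_cases hxB : (x : UnitAddCircle) ∈ B
  · have h5 := hB.mem_Icc_of_mem x (by simpa using h4) hxB
    exact h2 ⟨lt_of_le_of_ne h5.1 (Ne.symm h3), h5.2⟩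
  · exact h1 hxB

end IsShortArc

/-- A set on the circle whose lift to `(0, 1]` is an order-connected subset of a short interval admits integer frequencies that form a Riesz basis. -/
theorem exists_frequencies_of_ordConnected {B : Set UnitAddCircle} (hBm : MeasurableSet B)
    {p q : ℝ} (hp : 0 < p) (hq : q < 1) (hpq : q - p ≤ 1 / 10)
    (hB : ∀ x ∈ Ioc (0 : ℝ) 1, (x : UnitAddCircle) ∈ B → x ∈ Icc p q)
    (hord : ({x | x ∈ Ioc (0 : ℝ) 1 ∧ (x : UnitAddCircle) ∈ B} : Set ℝ).OrdConnected) :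
    ∃ Λ : Set ℤ, HasRieszLowerBound B Λ ∧ IsCompleteOn B Λ := by
  set S : Set ℝ := {x | x ∈ Ioc (0 : ℝ) 1 ∧ (x : UnitAddCircle) ∈ B} with hSdef
  have hSpq : S ⊆ Icc p q := fun x hx => hB x hx.1 hx.2
  have hbb : BddBelow S := ⟨p, fun x hx => (hSpq hx).1⟩
  have hba : BddAbove S := ⟨q, fun x hx => (hSpq hx).2⟩
  by_cases hS : S.Nonempty ∧ sInf S < sSup S
  · obtain ⟨hne, hlt⟩ := hS
    have hpi : p ≤ sInf S := le_csInf hne fun x hx => (hSpq hx).1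
    have hsq : sSup S ≤ q := csSup_le hne fun x hx => (hSpq hx).2
    have harc : IsShortArc B (sInf S) (sSup S - sInf S) := by
      refine ⟨hBm, hp.trans_le hpi, by linarith, by linarith, by linarith, ?_, ?_⟩
      · intro x hx
        rw [add_sub_cancel] at hx
        obtain ⟨y, hy, hyx⟩ := exists_lt_of_csInf_lt hne hx.1
        obtain ⟨z, hz, hxz⟩ := exists_lt_of_lt_csSup hne hx.2
        exact (hord.out hy hz ⟨hyx.le, hxz.le⟩).2
      · intro x hx hxB
        rw [add_sub_cancel]
        exact ⟨csInf_le hbb ⟨hx, hxB⟩, le_csSup hba ⟨hx, hxB⟩⟩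
    exact ⟨_, harc.hasRieszLowerBound, harc.isCompleteOn⟩
  -- In the degenerate case the lift has at most one point, so the set is null and no frequencies
  -- are needed.
  · have hsub : S.Subsingleton := by
      intro x hx y hy
      by_contra hxy
      refine hS ⟨⟨x, hx⟩, ?_⟩
      rcases lt_or_gt_of_ne hxy with h | h
      · exact (csInf_le hbb hx).trans_lt (h.trans_le (le_csSup hba hy))
      · exact (csInf_le hbb hy).trans_lt (h.trans_le (le_csSup hba hx))
    have hnull : volume B = 0 := by
      rw [← (UnitAddCircle.measurePreserving_mk 0).measure_preimage hBm.nullMeasurableSet,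
        Measure.restrict_apply (AddCircle.measurable_mk' hBm)]
      refine measure_mono_null (t := S) (fun x hx => ?_) (hsub.measure_zero _)
      exact ⟨by simpa using hx.2, hx.1⟩
    exact ⟨∅, hasRieszLowerBound_empty B, isCompleteOn_of_measure_zero hnull⟩

/-! ### Weyl equidistribution and Kronecker's theorem -/

section Kronecker

open Filter Topology UnitAddTorus

variable {d : Type*} [Fintype d]

theorem measureReal_univ_unitAddTorus : (volume : Measure (UnitAddTorus d)).real univ = 1 := by
  rw [measureReal_def, volume_pi, Measure.pi_univ]
  simp

theorem mFourier_add_arg (n : d → ℤ) (s t : UnitAddTorus d) :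
    mFourier n (s + t) = mFourier n s * mFourier n t := by
  simp only [mFourier, ContinuousMap.coe_mk, Pi.add_apply, fourier_add_arg, Finset.prod_mul_distrib]

theorem norm_mFourier_apply (n : d → ℤ) (t : UnitAddTorus d) : ‖mFourier n t‖ = 1 := by
  simp only [mFourier, ContinuousMap.coe_mk, norm_prod, norm_fourier_apply, Finset.prod_const_one]

theorem mFourier_nsmul (n : d → ℤ) (t : UnitAddTorus d) (k : ℕ) :
    mFourier n (k • t) = mFourier n t ^ k := by
  induction k with
  | zero => simp [mFourier]
  | succ k ih => rw [succ_nsmul, mFourier_add_arg, ih, pow_succ]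

/-- Translation by `ξ` preserves the integral and also multiplies it by `mFourier n ξ ≠ 1`. -/
theorem integral_mFourier_eq_zero {n : d → ℤ} {ξ : UnitAddTorus d} (hξ : mFourier n ξ ≠ 1) :
    ∫ t, mFourier n t = 0 := by
  have h := integral_add_right_eq_self (μ := (volume : Measure (UnitAddTorus d)))
    (fun t => mFourier n t) ξ
  simp_rw [mFourier_add_arg] at h
  rw [integral_mul_const] at h
  have h2 : (∫ t, mFourier n t) * (mFourier n ξ - 1) = 0 := by rw [mul_sub, h, mul_one, sub_self]
  exact (mul_eq_zero.mp h2).resolve_right (sub_ne_zero.mpr hξ)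

/-- The average of `g` over the first `M` multiples of `ξ`. -/
noncomputable def orbitAverage {d : Type*} (ξ : UnitAddTorus d) (M : ℕ) (g : C(UnitAddTorus d, ℂ)) : ℂ :=
  (M : ℂ)⁻¹ * ∑ k ∈ Finset.range M, g ((k + 1) • ξ)

theorem norm_orbitAverage_le {d : Type*} (ξ : UnitAddTorus d) (M : ℕ) (g : C(UnitAddTorus d, ℂ)) :
    ‖orbitAverage ξ M g‖ ≤ ‖g‖ := by
  rw [orbitAverage, norm_mul, norm_inv, Complex.norm_natCast]
  rcases Nat.eq_zero_or_pos M with rfl | hM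
  · simp
  have hM' : (0 : ℝ) < M := Nat.cast_pos.mpr hM
  rw [← div_eq_inv_mul, div_le_iff₀ hM']
  refine (norm_sum_le _ _).trans ((Finset.sum_le_sum fun k _ => g.norm_coe_le_norm _).trans ?_)
  simp [mul_comm]

/-- Weyl equidistribution of the multiples of `ξ`. -/
theorem tendsto_orbitAverage {ξ : UnitAddTorus d} (hξ : ∀ n : d → ℤ, n ≠ 0 → mFourier n ξ ≠ 1)
    (g : C(UnitAddTorus d, ℂ)) :
    Tendsto (fun M => orbitAverage ξ M g) atTop (𝓝 (∫ t, g t)) := by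
  have hgen : ∀ n : d → ℤ, Tendsto (fun M => orbitAverage ξ M (mFourier n)) atTop
      (𝓝 (∫ t, mFourier n t)) := by
    intro n
    by_cases hn : n = 0
    · subst hn
      refine Tendsto.congr' ?_ tendsto_const_nhds
      filter_upwards [eventually_gt_atTop 0] with M hM
      have hM' : (M : ℂ) ≠ 0 := Nat.cast_ne_zero.mpr hM.ne'
      simp [orbitAverage, mFourier_zero, hM', measureReal_univ_unitAddTorus]
    · have hz := hξ n hn
      rw [integral_mFourier_eq_zero hz]
      set z := mFourier n ξ with hzdef
      have hz1 : ‖z‖ = 1 := norm_mFourier_apply n ξ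
      -- The orbit sum of a nontrivial character is geometric with ratio `z ≠ 1` on the unit circle,
      -- hence bounded independently of `M`.
      have hbound : ∀ M, ‖orbitAverage ξ M (mFourier n)‖ ≤ (M : ℝ)⁻¹ * (2 / ‖z - 1‖) := by
        intro M
        rw [orbitAverage, norm_mul, norm_inv, Complex.norm_natCast]
        refine mul_le_mul_of_nonneg_left ?_ (by positivity)
        simp_rw [mFourier_nsmul, pow_succ]
        rw [← Finset.sum_mul, norm_mul, ← hzdef, hz1, mul_one, geom_sum_eq hz, norm_div]
        refine div_le_div_of_nonneg_right ?_ (norm_nonneg _)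
        refine (norm_sub_le _ _).trans ?_
        rw [norm_pow, hz1, one_pow, norm_one]
        norm_num
      refine squeeze_zero_norm hbound ?_
      have := (tendsto_inv_atTop_nhds_zero_nat (𝕜 := ℝ)).mul_const (2 / ‖z - 1‖)
      rwa [zero_mul] at this
  have hspan : ∀ f ∈ Submodule.span ℂ (range (mFourier (d := d))),
      Tendsto (fun M => orbitAverage ξ M f) atTop (𝓝 (∫ t, f t)) := by
    have hint : ∀ f : C(UnitAddTorus d, ℂ), Integrable (fun t => f t) volume := fun f =>
      f.continuous.integrable_of_hasCompactSupport (HasCompactSupport.of_compactSpace _)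
    intro f hf
    induction hf using Submodule.span_induction with
    | mem f hf =>
      obtain ⟨n, rfl⟩ := hf
      exact hgen n
    | zero => simp [orbitAverage]
    | add f g _ _ hf hg =>
      have h1 : ∫ t, (f + g) t = (∫ t, f t) + ∫ t, g t := integral_add (hint f) (hint g)
      rw [h1]
      refine (hf.add hg).congr fun M => ?_
      simp [orbitAverage, Finset.sum_add_distrib, mul_add]
    | smul c f _ hf =>
      have h1 : ∫ t, (c • f) t = c * ∫ t, f t := integral_const_mul c _
      rw [h1]
      refine (hf.const_mul c).congr fun M => ?_
      simp [orbitAverage, Finset.mul_sum, mul_left_comm]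
  -- Characters span a dense subspace, and both the averages and the integral are contractions in
  -- the sup norm, so convergence extends to `g`.
  have hg : g ∈ closure (Submodule.span ℂ (range (mFourier (d := d))) : Set C(UnitAddTorus d, ℂ)) := by
    rw [← Submodule.topologicalClosure_coe, span_mFourier_closure_eq_top]
    trivial
  rw [Metric.tendsto_atTop]
  intro ε hε
  obtain ⟨f, hf, hfg⟩ := Metric.mem_closure_iff.mp hg (ε / 3) (by positivity)
  obtain ⟨M₀, hM₀⟩ := Metric.tendsto_atTop.mp (hspan f hf) (ε / 3) (by positivity)
  refine ⟨M₀, fun M hM => ?_⟩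
  have h1 : dist (orbitAverage ξ M g) (orbitAverage ξ M f) ≤ dist g f := by
    rw [dist_eq_norm, dist_eq_norm]
    have : orbitAverage ξ M g - orbitAverage ξ M f = orbitAverage ξ M (g - f) := by
      simp [orbitAverage, Finset.sum_sub_distrib, mul_sub]
    rw [this]
    exact norm_orbitAverage_le ξ M _
  have h2 : dist (∫ t, f t) (∫ t, g t) ≤ dist g f := by
    have hint : ∀ f : C(UnitAddTorus d, ℂ), Integrable (fun t => f t) volume := fun f =>
      f.continuous.integrable_of_hasCompactSupport (HasCompactSupport.of_compactSpace _)
    rw [dist_eq_norm, ← integral_sub (hint f) (hint g)]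
    refine (norm_integral_le_of_norm_le_const (C := dist g f)
      (Eventually.of_forall fun t => ?_)).trans_eq ?_
    · rw [← dist_eq_norm, dist_comm g f]
      exact ContinuousMap.dist_apply_le_dist t
    · rw [measureReal_univ_unitAddTorus, mul_one]
  calc dist (orbitAverage ξ M g) (∫ t, g t)
      ≤ dist (orbitAverage ξ M g) (orbitAverage ξ M f) + dist (orbitAverage ξ M f) (∫ t, f t) +
        dist (∫ t, f t) (∫ t, g t) := dist_triangle4 _ _ _ _
    _ < ε := by linarith [hM₀ M hM]

/-- **Kronecker's theorem**: the positive multiples of `ξ` are dense if no nontrivial character is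
trivial at `ξ`. -/
theorem exists_nsmul_mem_of_isOpen {ξ : UnitAddTorus d}
    (hξ : ∀ n : d → ℤ, n ≠ 0 → mFourier n ξ ≠ 1) {U : Set (UnitAddTorus d)} (hU : IsOpen U)
    (hne : U.Nonempty) : ∃ N : ℕ, 0 < N ∧ N • ξ ∈ U := by
  by_contra! hcon
  obtain ⟨u, hu⟩ := hne
  -- A bump supported in `U` would have zero averages along an orbit that misses `U`, against a
  -- positive integral.
  obtain ⟨φ, hφ0, hφ1, hφI⟩ := exists_continuous_zero_one_of_isClosed hU.isClosed_compl
    (isClosed_singleton (x := u)) (disjoint_singleton_right.mpr (fun h => h hu))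
  have hpos : 0 < ∫ t, φ t := by
    refine Continuous.integral_pos_of_hasCompactSupport_nonneg_nonzero φ.continuous
      (HasCompactSupport.of_compactSpace _) (fun t => (hφI t).1) (x := u) ?_
    rw [hφ1 rfl]
    exact one_ne_zero
  let g : C(UnitAddTorus d, ℂ) := ⟨fun t => (φ t : ℂ), by fun_prop⟩
  have h1 : ∀ M, orbitAverage ξ M g = 0 := by
    intro M
    rw [orbitAverage, Finset.sum_eq_zero, mul_zero]
    intro k _
    have : φ ((k + 1) • ξ) = 0 := hφ0 (hcon (k + 1) k.succ_pos)
    simp [g, this]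
  have h2 := tendsto_orbitAverage hξ g
  simp_rw [h1] at h2
  have h3 := tendsto_nhds_unique h2 tendsto_const_nhds
  have h4 : ∫ t, g t = ((∫ t, φ t : ℝ) : ℂ) := integral_complex_ofReal
  rw [h4] at h3
  exact hpos.ne' (by exact_mod_cast h3)

/-- A quantitative form of Kronecker's theorem for real numbers. -/
theorem exists_nat_mul_sub_int_mem_Ioo {x : d → ℝ}
    (hx : ∀ k : d → ℤ, ∀ m : ℤ, ∑ i, k i * x i = m → k = 0) {p q : d → ℝ} (hpq : ∀ i, p i < q i) :
    ∃ N : ℕ, 0 < N ∧ ∀ i, ∃ k : ℤ, N * x i - k ∈ Ioo (p i) (q i) := by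
  let ξ : UnitAddTorus d := fun i => (x i : UnitAddCircle)
  have hξ : ∀ n : d → ℤ, n ≠ 0 → mFourier n ξ ≠ 1 := by
    intro n hn h
    have h1 : mFourier n ξ = Complex.exp ((∑ i, n i * x i : ℝ) * (2 * Real.pi * Complex.I)) := by
      simp only [mFourier, ContinuousMap.coe_mk, ξ, fourier_coe_apply]
      rw [← Complex.exp_sum]
      congr 1
      push_cast
      rw [Finset.sum_mul]
      refine Finset.sum_congr rfl fun i _ => ?_
      ring
    rw [h1, Complex.exp_eq_one_iff] at h
    obtain ⟨m, hm⟩ := h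
    have h2 := mul_right_cancel₀ Complex.two_pi_I_ne_zero hm
    exact hn (hx n m (by exact_mod_cast h2))
  obtain ⟨N, hN, hNU⟩ := exists_nsmul_mem_of_isOpen hξ
    (U := Set.pi univ fun i => ((↑) : ℝ → UnitAddCircle) '' Ioo (p i) (q i))
    (isOpen_set_pi finite_univ fun i _ => QuotientAddGroup.isOpenMap_coe _ isOpen_Ioo)
    (univ_pi_nonempty_iff.mpr fun i => (nonempty_Ioo.mpr (hpq i)).image _)
  refine ⟨N, hN, fun i => ?_⟩
  obtain ⟨r, hr, hrx⟩ := hNU i (mem_univ i)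
  have h1 : ((N * x i - r : ℝ) : UnitAddCircle) = 0 := by
    rw [AddCircle.coe_sub, hrx, ← nsmul_eq_mul, AddCircle.coe_nsmul, Pi.smul_apply, sub_self]
  obtain ⟨k, hk⟩ := (AddCircle.coe_eq_zero_iff 1).mp h1
  refine ⟨k, ?_⟩
  rw [zsmul_eq_mul, mul_one] at hk
  rwa [hk, sub_sub_cancel]

end Kronecker

/-! ### Level sets of the preimage count -/

section LevelSets

variable {N : ℕ} [NeZero N] {C : Set UnitAddCircle}

theorem measurable_card_fiberIndices (hC : MeasurableSet C) :
    Measurable fun t => (fiberIndices N C t).card := by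
  classical
  have h : ∀ t, (fiberIndices N C t).card =
      ∑ l : ZMod N, if t + ZMod.toAddCircle l ∈ C then 1 else 0 := fun t => by
    rw [fiberIndices, Finset.card_filter]
  simp_rw [h]
  exact Finset.measurable_fun_sum _ fun l _ =>
    Measurable.ite (measurable_add_const _ hC) measurable_const measurable_const

/-- The points of the circle with more than `j` preimages in `C` under multiplication by `N`. -/
def levelSet (N : ℕ) [NeZero N] (C : Set UnitAddCircle) (j : ℕ) : Set UnitAddCircle :=
  {w | j < (fiberIndices N C (divSection N w)).card}

theorem measurableSet_levelSet (hC : MeasurableSet C) (j : ℕ) :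
    MeasurableSet (levelSet N C j) :=
  ((measurable_card_fiberIndices hC).comp (measurable_divSection N)) measurableSet_Ioi

theorem zsmul_mem_levelSet (j : ℕ) (t : UnitAddCircle) :
    (N : ℤ) • t ∈ levelSet N C j ↔ j < (fiberIndices N C t).card := by
  obtain ⟨l, hl⟩ := exists_divSection_zsmul (N := N) t
  rw [levelSet, mem_ofPred_eq, hl, card_fiberIndices_add]

theorem coe_mem_levelSet (j : ℕ) (x : ℝ) :
    (x : UnitAddCircle) ∈ levelSet N C j ↔
      j < (fiberIndices N C ((x / N : ℝ) : UnitAddCircle)).card := by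
  rw [← zsmul_mem_levelSet, ← AddCircle.coe_zsmul, zsmul_eq_mul, Int.cast_natCast,
    mul_div_cancel₀ _ (NeZero.ne (N : ℝ))]

end LevelSets

theorem coe_mem_image_iff {S : Set ℝ} {x : ℝ} :
    (x : UnitAddCircle) ∈ ((↑) : ℝ → UnitAddCircle) '' S ↔ ∃ m : ℤ, x + m ∈ S := by
  constructor
  · rintro ⟨y, hy, hyx⟩
    have h1 : ((y - x : ℝ) : UnitAddCircle) = 0 := by rw [AddCircle.coe_sub, hyx, sub_self]
    obtain ⟨m, hm⟩ := (AddCircle.coe_eq_zero_iff 1).mp h1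
    refine ⟨m, ?_⟩
    rw [zsmul_eq_mul, mul_one] at hm
    rwa [hm, add_sub_cancel]
  · rintro ⟨m, hm⟩
    refine ⟨_, hm, ?_⟩
    rw [AddCircle.coe_add, add_eq_left, AddCircle.coe_eq_zero_iff]
    exact ⟨m, by simp⟩

/-! ### Level sets for a union of intervals -/

section UnionIntervals

variable {ι : Type*} {a b : ι → ℝ} {N : ℕ} [NeZero N]

theorem mem_fiberIndices_iUnion_Icc {u : ℝ} {l : ZMod N} :
    l ∈ fiberIndices N (((↑) : ℝ → UnitAddCircle) '' ⋃ j, Icc (a j) (b j))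
        ((u / N : ℝ) : UnitAddCircle) ↔
      ∃ (m : ℤ) (j : ι), a j * N ≤ u + l.val + m * N ∧ u + l.val + m * N ≤ b j * N := by
  have hN : (0 : ℝ) < N := Nat.cast_pos.mpr (NeZero.pos N)
  have h : ∀ m : ℤ, u / N + l.val / N + m = (u + l.val + m * N) / N := fun m => by
    field_simp
  rw [mem_fiberIndices, ZMod.toAddCircle_apply, ← AddCircle.coe_add, coe_mem_image_iff]
  simp only [mem_iUnion, mem_Icc, h, le_div_iff₀ hN, div_le_iff₀ hN]

/-- Moving to the right without crossing right endpoints does not lose preimages. -/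
theorem fiberIndices_mono {u v : ℝ} (huv : u ≤ v)
    (hb : ∀ (j : ι) (k : ℤ), u ≤ N * b j + k → v ≤ N * b j + k) :
    fiberIndices N (((↑) : ℝ → UnitAddCircle) '' ⋃ j, Icc (a j) (b j))
        ((u / N : ℝ) : UnitAddCircle) ⊆
      fiberIndices N (((↑) : ℝ → UnitAddCircle) '' ⋃ j, Icc (a j) (b j))
        ((v / N : ℝ) : UnitAddCircle) := by
  intro l hl
  rw [mem_fiberIndices_iUnion_Icc] at hl ⊢
  obtain ⟨m, j, h1, h2⟩ := hl
  refine ⟨m, j, by linarith, ?_⟩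
  -- The lifted point is `u + l + m * N`, so passing the right endpoint there means that `u` passes
  -- `N * b j` shifted by this integer.
  have h3 := hb j (-(l.val : ℤ) - m * N) (by push_cast; linarith)
  push_cast at h3
  linarith

/-- Moving to the left without crossing left endpoints does not lose preimages. -/
theorem fiberIndices_anti {u v : ℝ} (huv : u ≤ v)
    (ha : ∀ (j : ι) (k : ℤ), N * a j + k ≤ v → N * a j + k ≤ u) :
    fiberIndices N (((↑) : ℝ → UnitAddCircle) '' ⋃ j, Icc (a j) (b j))
        ((v / N : ℝ) : UnitAddCircle) ⊆
      fiberIndices N (((↑) : ℝ → UnitAddCircle) '' ⋃ j, Icc (a j) (b j))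
        ((u / N : ℝ) : UnitAddCircle) := by
  intro l hl
  rw [mem_fiberIndices_iUnion_Icc] at hl ⊢
  obtain ⟨m, j, h1, h2⟩ := hl
  refine ⟨m, j, ?_, by linarith⟩
  have h3 := ha j (-(l.val : ℤ) - m * N) (by push_cast; linarith)
  push_cast at h3
  linarith

theorem int_eq_zero_of_add_mem {r : ℝ} (hr : 0.45 < r ∧ r < 0.55) {i : ℤ} (h0 : 0 ≤ r + i)
    (h1 : r + i ≤ 1) : i = 0 := by
  have h2 : (-1 : ℝ) < i := by linarith
  have h3 : (i : ℝ) < 1 := by linarith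
  have h4 : -1 < i := by exact_mod_cast h2
  have h5 : i < 1 := by exact_mod_cast h3
  omega

/-- If multiplication by `N` moves the left endpoints slightly to the left and the right endpoints
slightly to the right of `1 / 2`, then every level set admits frequencies. -/
theorem exists_frequencies_levelSet
    (hC : MeasurableSet (((↑) : ℝ → UnitAddCircle) '' ⋃ j, Icc (a j) (b j)))
    (ha : ∀ j, ∃ k : ℤ, N * a j - k ∈ Ioo (0.45 : ℝ) 0.5)
    (hb : ∀ j, ∃ k : ℤ, N * b j - k ∈ Ioo (0.5 : ℝ) 0.55) (j : ℕ) :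
    ∃ Λ : Set ℤ,
      HasRieszLowerBound (levelSet N (((↑) : ℝ → UnitAddCircle) '' ⋃ j, Icc (a j) (b j)) j) Λ ∧
      IsCompleteOn (levelSet N (((↑) : ℝ → UnitAddCircle) '' ⋃ j, Icc (a j) (b j)) j) Λ := by
  -- Inside `[0, 1]` the only translate of a scaled left endpoint lies in `(0.45, 0.5)`; `hb'` is
  -- the analogue for right endpoints in `(0.5, 0.55)`.
  have ha' : ∀ j (k : ℤ), 0 ≤ N * a j + k → N * a j + k ≤ 1 →
      0.45 < N * a j + k ∧ N * a j + k < 0.5 := by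
    intro j k h0 h1
    obtain ⟨k₀, hk₀⟩ := ha j
    have := int_eq_zero_of_add_mem (r := N * a j - k₀) (i := k + k₀)
      ⟨hk₀.1, by linarith [hk₀.2]⟩ (by push_cast; linarith) (by push_cast; linarith)
    obtain rfl : k = -k₀ := by omega
    push_cast
    exact hk₀
  have hb' : ∀ j (k : ℤ), 0 ≤ N * b j + k → N * b j + k ≤ 1 →
      0.5 < N * b j + k ∧ N * b j + k < 0.55 := by
    intro j k h0 h1
    obtain ⟨k₀, hk₀⟩ := hb j
    have := int_eq_zero_of_add_mem (r := N * b j - k₀) (i := k + k₀)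
      ⟨by linarith [hk₀.1], hk₀.2⟩ (by push_cast; linarith) (by push_cast; linarith)
    obtain rfl : k = -k₀ := by omega
    push_cast
    exact hk₀
  set C := ((↑) : ℝ → UnitAddCircle) '' ⋃ j, Icc (a j) (b j) with hCdef
  let cnt : ℝ → ℕ := fun u => (fiberIndices N C ((u / N : ℝ) : UnitAddCircle)).card
  have hmono : ∀ u v, 0 ≤ u → u ≤ v → v ≤ 0.5 ∨ (0.55 ≤ u ∧ v ≤ 1) → cnt u ≤ cnt v := by
    intro u v h0 huv hv
    refine Finset.card_le_card (fiberIndices_mono huv fun j k h1 => ?_)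
    by_contra h2
    have h3 := hb' j k (by linarith) (by rcases hv with h | h <;> linarith)
    rcases hv with h | h <;> linarith
  have hanti : ∀ u v, 0 ≤ u → u ≤ v → v ≤ 0.45 ∨ (0.5 ≤ u ∧ v ≤ 1) → cnt v ≤ cnt u := by
    intro u v h0 huv hv
    refine Finset.card_le_card (fiberIndices_anti huv fun j k h1 => ?_)
    by_contra h2
    have h3 := ha' j k (by linarith) (by rcases hv with h | h <;> linarith)
    rcases hv with h | h <;> linarith
  -- The points `0 / N` and `1 / N` lie in the same fiber, so the count closes up around the circle.
  have h01 : cnt 1 = cnt 0 := by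
    have h := card_fiberIndices_add C ((0 / N : ℝ) : UnitAddCircle) ((1 : ℕ) : ZMod N)
    rw [ZMod.toAddCircle_natCast, ← AddCircle.coe_add, ← add_div, zero_add, Nat.cast_one] at h
    exact h
  have hmem : ∀ x : ℝ, (x : UnitAddCircle) ∈ levelSet N C j ↔ j < cnt x := coe_mem_levelSet j
  -- The count is unimodal on `[0, 1]` with minimum `cnt 0 = cnt 1`: below that level the level set
  -- is everything, from it on an interval around `1/2`.
  by_cases hj : j < cnt 0
  · have huniv : levelSet N C j = univ := by
      refine eq_univ_of_forall fun w => ?_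
      obtain ⟨x, hx, rfl⟩ : ∃ x ∈ Ioc (0 : ℝ) (0 + 1), (x : UnitAddCircle) = w :=
        ⟨_, (AddCircle.equivIoc 1 0 w).2, (AddCircle.equivIoc 1 0).symm_apply_apply w⟩
      rw [hmem]
      rcases le_total x 0.5 with h | h
      · exact hj.trans_le (hmono 0 x le_rfl hx.1.le (Or.inl h))
      · rw [← h01] at hj
        exact hj.trans_le (hanti x 1 hx.1.le (by linarith [hx.2]) (Or.inr ⟨h, le_rfl⟩))
    rw [huniv]
    exact ⟨univ, hasRieszLowerBound_univ, isCompleteOn_univ⟩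
  · refine exists_frequencies_of_ordConnected (measurableSet_levelSet hC j) (p := 0.45) (q := 0.55)
      (by norm_num) (by norm_num) (by norm_num) ?_ ?_
    · intro x hx hxB
      rw [hmem] at hxB
      by_contra hcon
      rcases lt_or_ge x 0.45 with h | h
      · exact hj (hxB.trans_le (hanti 0 x le_rfl hx.1.le (Or.inl h.le)))
      · have h2 : 0.55 < x := by
          by_contra h3
          exact hcon ⟨h, not_lt.mp h3⟩
        rw [← h01] at hj
        exact hj (hxB.trans_le (hmono x 1 hx.1.le hx.2 (Or.inr ⟨h2.le, le_rfl⟩)))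
    · refine ⟨fun x hx y hy z hz => ?_⟩
      simp only [hmem, mem_ofPred_eq] at hx hy ⊢
      refine ⟨⟨hx.1.1.trans_le hz.1, hz.2.trans hy.1.2⟩, ?_⟩
      rcases le_total z 0.5 with h | h
      · exact hx.2.trans_le (hmono x z hx.1.1.le hz.1 (Or.inl h))
      · exact hy.2.trans_le (hanti z y (by linarith) hz.2 (Or.inr ⟨h, hy.1.2⟩))

end UnionIntervals

/-! ### The main theorem -/

theorem claim4p3 (L : ℕ) (a b : Fin L → ℝ) (S : Set ℝ)
    (hab : ∀ j, a j ≤ b j)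
    (hS : S = ⋃ j, Set.Icc (a j) (b j))
    (hS01 : S ⊆ Set.Icc 0 1)
    (hind : LinearIndependent ℚ (Sum.elim (Sum.elim a b) (fun _ : Unit => (1 : ℝ)))) :
    ∃ Λ : Set ℤ, IsExpRieszBasis S (fun n : Λ => ((n : ℤ) : ℝ)) := by
  subst hS
  obtain ⟨N, hN, hNk⟩ := exists_nat_mul_sub_int_mem_Ioo (x := Sum.elim a b)
    (p := Sum.elim (fun _ => 0.45) fun _ => 0.5) (q := Sum.elim (fun _ => 0.5) fun _ => 0.55)
    (by
      intro k m hkm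
      rw [Fintype.linearIndependent_iff] at hind
      -- An integer relation `∑ k i * x i = m` is a rational relation with coefficient `-m` on the
      -- vector `1`.
      have h := hind (Sum.elim (fun i => (k i : ℚ)) fun _ => -(m : ℚ)) (by
        rw [Fintype.sum_sum_type]
        simp only [Sum.elim_inl, Sum.elim_inr, Rat.smul_def]
        push_cast
        rw [hkm]
        simp)
      funext i
      have := h (Sum.inl i)
      simpa using this)
    (by rintro (i | i) <;> norm_num)
  have : NeZero N := ⟨hN.ne'⟩
  have ha : ∀ j, ∃ k : ℤ, N * a j - k ∈ Ioo (0.45 : ℝ) 0.5 := fun j => hNk (Sum.inl j)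
  have hb : ∀ j, ∃ k : ℤ, N * b j - k ∈ Ioo (0.5 : ℝ) 0.55 := fun j => hNk (Sum.inr j)
  -- An integer endpoint would make `N * r - k` an integer strictly between 0 and 1. Hence `S`
  -- avoids `0` and `1`, and lifts from the circle to `(0, 1]` without wrap-around.
  have hne : ∀ {r p q : ℝ}, 0 < p → q < 1 → (∃ k : ℤ, N * r - k ∈ Ioo p q) →
      ∀ i : ℤ, r ≠ i := by
    rintro r p q hp hq ⟨k, hk1, hk2⟩ i rfl
    have h1 : (0 : ℝ) < ((N * i - k : ℤ) : ℝ) := by push_cast; linarith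
    have h2 : ((N * i - k : ℤ) : ℝ) < 1 := by push_cast; linarith
    have h3 : 0 < (N : ℤ) * i - k := by exact_mod_cast h1
    have h4 : (N : ℤ) * i - k < 1 := by exact_mod_cast h2
    omega
  have hIoo : ⋃ j, Icc (a j) (b j) ⊆ Ioo (0 : ℝ) 1 := by
    intro x hx
    obtain ⟨j, hxj⟩ := mem_iUnion.mp hx
    have h0 : 0 ≤ a j := (hS01 (mem_iUnion.mpr ⟨j, left_mem_Icc.mpr (hab j)⟩)).1
    have h1 : b j ≤ 1 := (hS01 (mem_iUnion.mpr ⟨j, right_mem_Icc.mpr (hab j)⟩)).2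
    have h0' : a j ≠ 0 := by
      have := hne (by norm_num) (by norm_num) (ha j) 0
      simpa using this
    have h1' : b j ≠ 1 := by
      have := hne (by norm_num) (by norm_num) (hb j) 1
      simpa using this
    exact ⟨(lt_of_le_of_ne h0 h0'.symm).trans_le hxj.1, hxj.2.trans_lt (lt_of_le_of_ne h1 h1')⟩
  have hcomp : IsCompact (⋃ j, Icc (a j) (b j)) := isCompact_iUnion fun j => isCompact_Icc
  have hC : MeasurableSet (((↑) : ℝ → UnitAddCircle) '' ⋃ j, Icc (a j) (b j)) :=
    (hcomp.image (AddCircle.continuous_mk' 1)).isClosed.measurableSet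
  -- Levels `j < N` suffice, since a fiber has only `N` points.
  choose Λ hlow hcompl using fun j : Fin N => exists_frequencies_levelSet hC ha hb (j : ℕ)
  refine ⟨_, isExpRieszBasis_of_circle hIoo hcomp.measurableSet hC (fun x hx => ?_)
    (hasRieszLowerBound_combine hC (fun j => measurableSet_levelSet hC j)
      (fun j t => zsmul_mem_levelSet j t) hlow)
    (isCompleteOn_combine (fun j => measurableSet_levelSet hC j)
      (fun j t => zsmul_mem_levelSet j t) hcompl)⟩
  rw [coe_mem_image_iff]
  constructor
  · rintro ⟨m, hm⟩
    have h1 := hIoo hm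
    have h2 : (-1 : ℝ) < m := by linarith [h1.1, hx.2]
    have h3 : (m : ℝ) < 1 := by linarith [h1.2, hx.1]
    have h4 : -1 < m := by exact_mod_cast h2
    have h5 : m < 1 := by exact_mod_cast h3
    obtain rfl : m = 0 := by omega
    simpa using hm
  · intro h
    exact ⟨0, by simpa using h⟩
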